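/- Let $\mathsf k$ be a complex Hilbert space. For an interval $A\subseteq\mathbb R_+=[0,\infty)$ let $\mathcal F_A$ be the Boson Fock space over $L^2(A;\mathsf k)$, with exponential vectors $\varepsilon(f)=\bigl(f^{\otimes n}/\sqrt{n!}\bigr)_{n\ge0}$; put $\mathcal F=\mathcal F_{[0,\infty)}$, $\mathcal F_{t)}=\mathcal F_{[0,t)}$, $\mathcal F_{[t}=\mathcal F_{[t,\infty)}$, and identify $\mathcal F=\mathcal F_{t)}\otimes\mathcal F_{[t}$ by $\varepsilon(f)\leftrightarrow\varepsilon(f|_{[0,t)})\otimes\varepsilon(f|_{[t,\infty)})$. All tensor products are Hilbert-space tensor products. For $t\in[0,\infty)$ let $E_t$ be the orthogonal projection of $\mathcal F$ onto $\mathcal F_{t)}\otimes\varepsilon(0|_{[t,\infty)})$ (so $E_0$ is the projection onto $\mathbb C\varepsilon(0)$), and let $\Gamma_t$ be the isometry on $\mathcal F$ with $\Gamma_t\varepsilon(f)=\varepsilon(\theta_tf)$, where $(\theta_tf)(r)=1_{[t,\infty)}(r)f(r-t)$; its range is $\varepsilon(0|_{[0,t)})\otimes\mathcal F_{[t}$,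 and $\Gamma_tx$ is also regarded as an element of $\mathcal F_{[t}$. Put $E_\infty=I$ and $\Gamma_\infty=E_0$. A finite quantum stop time $S$ is a map from the Borel subsets of $[0,\infty]$ to the orthogonal projections on $\mathcal F$ such that $A\mapsto\langle x,S(A)y\rangle$ is a complex measure for all $x,y\in\mathcal F$, $S([0,\infty])=I$, $S(\{0\})=0$, $S(\{\infty\})=0$, and $S([0,t])\in B(\mathcal F_{t)})\otimes I_{[t}$ for all $t\in(0,\infty)$. For $t\in(0,\infty]$ and $v:[0,\infty]\to\mathcal F$ write $$\int_{[0,t]}S(ds)\,v(s)=\lim_\pi\sum_{j=1}^{n+1}S\bigl((\pi_{j-1},\pi_j]\bigr)v(\pi_j)$$ when this limit exists in norm, over the finite partitions $\pi=\{0=\pi_0<\dots<\pi_{n+1}=t\}$ directed by refinement. When $v(s)=\varepsilon(f|_{[0,s)})\otimes F_s$ with $F_s\in\mathcal F_{[s}$ for $s<\infty$, the convention is $v(\infty)=\varepsilon(f)$. **Theorem.** Let $S$ be a finite quantum stop time. 1. For each $t\in(0,\infty]$ there is an orthogonal projection $E_{S,t}$ on $\mathcal F$ such that, for all $f\in L^2(\mathbb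 R_+;\mathsf k)$, $$E_{S,t}\,\varepsilon(f)=\int_{[0,t]}S(ds)\,E_s\varepsilon(f)=\int_{[0,t]}S(ds)\,\varepsilon(f|_{[0,s)})\otimes\varepsilon(0|_{[s,\infty)}),$$ both integrals existing. Moreover $E_{S,s}E_{S,t}=E_{S,s\wedge t}=E_{S,t}E_{S,s}$ and $S([0,s])E_{S,\infty}=E_{S,s}$ for all $s,t\in(0,\infty]$. 2. There is an isometry $\Gamma_S$ on $\mathcal F$ such that, for all $x\in\mathcal F$, $$\Gamma_Sx=\int_{[0,\infty]}S(ds)\,\Gamma_sx=\int_{[0,\infty]}S(ds)\,\varepsilon(0|_{[0,s)})\otimes\Gamma_sx,$$ both integrals existing. 3. Let $E_S=E_{S,\infty}$, $\mathcal F_{S)}=\operatorname{im}E_S$ and $\mathcal F_{[S}=\operatorname{im}\Gamma_S$. Then $E_{S,t}\varepsilon(f)\in\mathcal F_{S)}$ for all $t\in(0,\infty]$ and $f\in L^2(\mathbb R_+;\mathsf k)$, and there is an isometric isomorphism $j_S:\mathcal F_{S)}\otimes\mathcal F_{[S}\to\mathcal F$ (onto $\mathcal F$) such that, for all $t\in(0,\infty]$,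 $f\in L^2(\mathbb R_+;\mathsf k)$ and $x\in\mathcal F$, $$j_S\bigl(E_{S,t}\varepsilon(f)\otimes\Gamma_Sx\bigr)=\int_{[0,t]}S(ds)\,\varepsilon(f|_{[0,s)})\otimes\Gamma_sx,$$ the integral existing. -/

import Mathlib

open MeasureTheory Filter Topology
open scoped NNReal ENNReal TensorProduct

noncomputable section

namespace CCR

universe u

/-- The Hilbert-space tensor product: the completion of the algebraic tensor product. -/
abbrev HTensor (E F : Type*) [NormedAddCommGroup E] [InnerProductSpace ℂ E]
    [NormedAddCommGroup F] [InnerProductSpace ℂ F] : Type _ :=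
  UniformSpace.Completion (E ⊗[ℂ] F)

/-- The elementary tensor `x ⊗ y` in the Hilbert-space tensor product. -/
def htmul {E F : Type*} [NormedAddCommGroup E] [InnerProductSpace ℂ E]
    [NormedAddCommGroup F] [InnerProductSpace ℂ F] (x : E) (y : F) : HTensor E F :=
  ((x ⊗ₜ[ℂ] y : E ⊗[ℂ] F) : UniformSpace.Completion (E ⊗[ℂ] F))

theorem inner_htmul {E F : Type*} [NormedAddCommGroup E] [InnerProductSpace ℂ E]
    [NormedAddCommGroup F] [InnerProductSpace ℂ F] (x x' : E) (y y' : F) :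
    inner ℂ (htmul x y) (htmul x' y') = inner ℂ x x' * inner ℂ y y' := by
  simp [htmul]

/-- A bundled complex Hilbert space (used only to define tensor powers by recursion). -/
structure HilbertType where
  carrier : Type u
  [group : NormedAddCommGroup carrier]
  [innerSpace : InnerProductSpace ℂ carrier]
  [complete : CompleteSpace carrier]

attribute [instance] HilbertType.group HilbertType.innerSpace HilbertType.complete

/-- The `n`-th Hilbert-space tensor power of `H`; the zeroth power is one-dimensional. -/
def tensorPow (H : Type u) [NormedAddCommGroup H] [InnerProductSpace ℂ H] : ℕ → HilbertType.{u}
  | 0 => ⟨EuclideanSpace ℂ PUnit.{u + 1}⟩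
  | n + 1 => ⟨HTensor H (tensorPow H n).carrier⟩

/-- The tensor power `f ⊗ ⋯ ⊗ f` (`n` factors). -/
def powVec {H : Type u} [NormedAddCommGroup H] [InnerProductSpace ℂ H] (f : H) :
    (n : ℕ) → (tensorPow H n).carrier
  | 0 => (EuclideanSpace.single PUnit.unit 1 : EuclideanSpace ℂ PUnit.{u + 1})
  | n + 1 => (htmul f (powVec f n) : HTensor H (tensorPow H n).carrier)

theorem inner_powVec {H : Type u} [NormedAddCommGroup H] [InnerProductSpace ℂ H] (f g : H)
    (n : ℕ) : inner ℂ (powVec f n) (powVec g n) = (inner ℂ f g) ^ n := by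
  induction n with
  | zero =>
    change inner ℂ (EuclideanSpace.single PUnit.unit 1 : EuclideanSpace ℂ PUnit.{u + 1})
      (EuclideanSpace.single PUnit.unit 1 : EuclideanSpace ℂ PUnit.{u + 1}) = _
    simp
  | succ n ih =>
    change inner ℂ (htmul f (powVec f n)) (htmul g (powVec g n)) = _
    rw [inner_htmul, ih, pow_succ']

theorem norm_powVec {H : Type u} [NormedAddCommGroup H] [InnerProductSpace ℂ H] (f : H)
    (n : ℕ) : ‖powVec f n‖ = ‖f‖ ^ n := by
  have h := inner_powVec f f n
  rw [inner_self_eq_norm_sq_to_K, inner_self_eq_norm_sq_to_K, ← pow_mul, mul_comm 2 n,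
    pow_mul] at h
  have h2 : ‖powVec f n‖ ^ 2 = (‖f‖ ^ n) ^ 2 := by exact_mod_cast h
  exact (sq_eq_sq₀ (norm_nonneg _) (by positivity)).1 h2

/-- The `n`-th symmetric tensor power: the closed linear span of the vectors `f ⊗ ⋯ ⊗ f`. -/
def symPow (H : Type u) [NormedAddCommGroup H] [InnerProductSpace ℂ H] (n : ℕ) :
    Submodule ℂ (tensorPow H n).carrier :=
  (Submodule.span ℂ (Set.range fun f : H => powVec f n)).topologicalClosure

instance (H : Type u) [NormedAddCommGroup H] [InnerProductSpace ℂ H] (n : ℕ) :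
    CompleteSpace (symPow H n) :=
  inferInstanceAs (CompleteSpace (Submodule.topologicalClosure _))

/-- Boson Fock space over `H`: the Hilbert-space direct sum of the symmetric tensor powers. -/
abbrev Fock (H : Type u) [NormedAddCommGroup H] [InnerProductSpace ℂ H] : Type u :=
  lp (fun n : ℕ => symPow H n) 2

/-- The component `f ⊗ ⋯ ⊗ f / √n!` of an exponential vector. -/
def expComp {H : Type u} [NormedAddCommGroup H] [InnerProductSpace ℂ H] (f : H) (n : ℕ) :
    symPow H n :=
  (((Real.sqrt (n.factorial : ℝ))⁻¹ : ℝ) : ℂ) •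
    ⟨powVec f n, Submodule.le_topologicalClosure _ (Submodule.subset_span ⟨f, rfl⟩)⟩

theorem inner_expComp {H : Type u} [NormedAddCommGroup H] [InnerProductSpace ℂ H] (f g : H)
    (n : ℕ) : inner ℂ (expComp f n) (expComp g n) = (inner ℂ f g) ^ n / (n.factorial : ℂ) := by
  have h : ((Real.sqrt (n.factorial : ℝ) : ℝ) : ℂ) * ((Real.sqrt (n.factorial : ℝ) : ℝ) : ℂ)
      = (n.factorial : ℂ) := by
    rw [← Complex.ofReal_mul, Real.mul_self_sqrt (by positivity)]; simp
  rw [expComp, expComp, inner_smul_left, inner_smul_right, Submodule.coe_inner, inner_powVec,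
    Complex.conj_ofReal, Complex.ofReal_inv, ← h, div_eq_mul_inv, mul_inv]
  ring

theorem memlp_expComp {H : Type u} [NormedAddCommGroup H] [InnerProductSpace ℂ H] (f : H) :
    Memℓp (expComp f) 2 := by
  refine memℓp_gen ?_
  have h : ∀ n, ‖expComp f n‖ ^ (2 : ℝ≥0∞).toReal = (‖f‖ ^ 2) ^ n / (n.factorial : ℝ) := by
    intro n
    have h1 := inner_expComp f f n
    rw [inner_self_eq_norm_sq_to_K, inner_self_eq_norm_sq_to_K] at h1
    have h2 : ‖expComp f n‖ ^ 2 = (‖f‖ ^ 2) ^ n / (n.factorial : ℝ) := by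
      apply Complex.ofReal_injective
      push_cast
      exact h1
    simpa using h2
  simp_rw [h]
  exact Real.summable_pow_div_factorial _

/-- The exponential vector `ε(f)`, with components `f ⊗ ⋯ ⊗ f / √n!`. -/
def expVec {H : Type u} [NormedAddCommGroup H] [InnerProductSpace ℂ H] (f : H) : Fock H :=
  ⟨expComp f, memlp_expComp f⟩

theorem inner_expVec {H : Type u} [NormedAddCommGroup H] [InnerProductSpace ℂ H] (f g : H) :
    inner ℂ (expVec f) (expVec g) = Complex.exp (inner ℂ f g) := by
  rw [lp.inner_eq_tsum, Complex.exp_eq_exp_ℂ, NormedSpace.exp_eq_tsum_div]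
  exact tsum_congr fun n => inner_expComp f g n

theorem powVec_smul {H : Type u} [NormedAddCommGroup H] [InnerProductSpace ℂ H] (z : ℂ) (f : H)
    (n : ℕ) : powVec (z • f) n = z ^ n • powVec f n := by
  induction n with
  | zero => rw [pow_zero, one_smul]; rfl
  | succ n ih =>
    change htmul (z • f) (powVec (z • f) n) = z ^ (n + 1) • htmul f (powVec f n)
    rw [ih, htmul, htmul, TensorProduct.smul_tmul_smul, UniformSpace.Completion.coe_smul, pow_succ']

/-- The exponential vectors are total. -/
theorem span_expVec (H : Type u) [NormedAddCommGroup H] [InnerProductSpace ℂ H] :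
    (Submodule.span ℂ (Set.range (expVec : H → Fock H))).topologicalClosure = ⊤ := by
  rw [Submodule.topologicalClosure_eq_top_iff, Submodule.eq_bot_iff]
  intro x hx
  have hx0 : ∀ f : H, inner ℂ x (expVec f) = 0 := fun f =>
    Submodule.inner_left_of_mem_orthogonal (Submodule.subset_span (Set.mem_range_self f)) hx
  have key : ∀ (f : H) (n : ℕ), inner ℂ (x n) (expComp f n) = 0 := by
    intro f n
    set c : ℕ → ℂ := fun n => inner ℂ (x n) (expComp f n)
    have hs : ∀ z : ℂ, HasSum (fun n => z ^ n • c n) 0 := by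
      intro z
      have h := lp.hasSum_inner (𝕜 := ℂ) x (expVec (z • f))
      rw [hx0] at h
      refine h.congr_fun fun n => ?_
      have h1 : expComp (z • f) n = z ^ n • expComp f n := by
        rw [expComp, expComp, smul_comm]
        congr 1
        exact Subtype.ext (powVec_smul z f n)
      change _ = inner ℂ (x n) (expComp (z • f) n)
      rw [h1, inner_smul_right, smul_eq_mul]
    have hp : HasFPowerSeriesAt (0 : ℂ → ℂ) (FormalMultilinearSeries.ofScalars ℂ c) 0 := by
      rw [hasFPowerSeriesAt_iff]
      exact Eventually.of_forall fun z => by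
        simpa [FormalMultilinearSeries.coeff_ofScalars] using hs z
    have h0 : (FormalMultilinearSeries.ofScalars ℂ c).coeff n =
        (0 : FormalMultilinearSeries ℂ ℂ ℂ).coeff n := by rw [hp.eq_zero]
    rwa [FormalMultilinearSeries.coeff_ofScalars] at h0
  ext n : 2
  have hn : ((x n : symPow H n) : (tensorPow H n).carrier) ∈
      (Submodule.span ℂ (Set.range fun f : H => powVec f n))ᗮ := by
    rw [Submodule.mem_orthogonal']
    intro u hu
    induction hu using Submodule.span_induction with
    | mem u hu =>
      obtain ⟨f, rfl⟩ := hu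
      have := key f n
      rw [expComp, inner_smul_right] at this
      rcases mul_eq_zero.1 this with h | h
      · exfalso
        have hpos : (0 : ℝ) < (Real.sqrt (n.factorial : ℝ))⁻¹ := by positivity
        exact hpos.ne' (by exact_mod_cast h)
      · exact h
    | zero => simp
    | add u v _ _ hu hv => rw [inner_add_right, hu, hv, add_zero]
    | smul a u _ hu => rw [inner_smul_right, hu, mul_zero]
  rw [← Submodule.orthogonal_closure] at hn
  have := Submodule.inner_right_of_mem_orthogonal (x n).2 hn
  simpa using this

/-- An isometry is determined by its inner products on a total family. -/
theorem exists_isometry_of_gram {ι E F : Type*} [NormedAddCommGroup E] [InnerProductSpace ℂ E]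
    [NormedAddCommGroup F] [InnerProductSpace ℂ F] [CompleteSpace F] (e : ι → E) (e' : ι → F)
    (he : (Submodule.span ℂ (Set.range e)).topologicalClosure = ⊤)
    (h : ∀ i j, inner ℂ (e' i) (e' j) = inner ℂ (e i) (e j)) :
    ∃ V : E →ₗᵢ[ℂ] F, ∀ i, V (e i) = e' i := by
  set L := Finsupp.linearCombination ℂ e
  set L' := Finsupp.linearCombination ℂ e'
  have hin : ∀ c d, inner ℂ (L' c) (L' d) = inner ℂ (L c) (L d) := by
    intro c d
    simp only [L, L', Finsupp.linearCombination_apply, Finsupp.sum_inner, Finsupp.inner_sum,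
      inner_smul_left, inner_smul_right, h]
  have hnorm : ∀ c, ‖L' c‖ = ‖L c‖ := by
    intro c
    rw [@norm_eq_sqrt_re_inner ℂ, @norm_eq_sqrt_re_inner ℂ, hin]
  have hd : DenseRange L := by
    rw [DenseRange, ← LinearMap.coe_range, Finsupp.range_linearCombination]
    exact Submodule.dense_iff_topologicalClosure_eq_top.2 he
  have hC : ∃ C, ∀ x, ‖L' x‖ ≤ C * ‖L x‖ := ⟨1, fun x => by rw [one_mul, hnorm]⟩
  have hV : ∀ c, L'.extendOfNorm L (L c) = L' c := LinearMap.extendOfNorm_eq hd hC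
  refine ⟨⟨(L'.extendOfNorm L).toLinearMap, fun x => ?_⟩, fun i => ?_⟩
  · refine hd.induction_on (p := fun x => ‖L'.extendOfNorm L x‖ = ‖x‖) x
      (isClosed_eq (by fun_prop) (by fun_prop)) fun c => ?_
    rw [hV, hnorm]
  · have := hV (Finsupp.single i 1)
    simpa [L, L'] using this

/-- Second quantisation of an isometry `V`: the isometry with `ε(f) ↦ ε(V f)`. -/
def secondQuant {H K : Type*} [NormedAddCommGroup H] [InnerProductSpace ℂ H]
    [NormedAddCommGroup K] [InnerProductSpace ℂ K] (V : H →ₗᵢ[ℂ] K) : Fock H →ₗᵢ[ℂ] Fock K :=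
  (exists_isometry_of_gram (expVec : H → Fock H) (fun f => expVec (V f)) (span_expVec H)
    (fun f g => by simp only [inner_expVec, V.inner_map_map])).choose

theorem secondQuant_expVec {H K : Type*} [NormedAddCommGroup H] [InnerProductSpace ℂ H]
    [NormedAddCommGroup K] [InnerProductSpace ℂ K] (V : H →ₗᵢ[ℂ] K) (f : H) :
    secondQuant V (expVec f) = expVec (V f) :=
  (exists_isometry_of_gram (expVec : H → Fock H) (fun f => expVec (V f)) (span_expVec H)
    (fun f g => by simp only [inner_expVec, V.inner_map_map])).choose_spec f

/-- `L²(A; k)`, for a set `A` of reals. -/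
abbrev L2 (k : Type u) [NormedAddCommGroup k] (A : Set ℝ) : Type u :=
  Lp k 2 ((volume : Measure ℝ).restrict A)

/-- Boson Fock space over `L²([0, ∞); k)`. -/
abbrev FockSpace (k : Type u) [NormedAddCommGroup k] [InnerProductSpace ℂ k] : Type u :=
  Fock (L2 k (Set.Ici 0))

/-- Boson Fock space over `L²([0, t); k)`. -/
abbrev FockBefore (k : Type u) [NormedAddCommGroup k] [InnerProductSpace ℂ k] (t : ℝ≥0) :
    Type u :=
  Fock (L2 k (Set.Ico 0 (t : ℝ)))

/-- Boson Fock space over `L²([t, ∞); k)`. -/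
abbrev FockAfter (k : Type u) [NormedAddCommGroup k] [InnerProductSpace ℂ k] (t : ℝ≥0) :
    Type u :=
  Fock (L2 k (Set.Ici (t : ℝ)))

/-- The restriction `f|_[0, t)`. -/
def before {k : Type u} [NormedAddCommGroup k] (t : ℝ≥0) (f : L2 k (Set.Ici 0)) :
    L2 k (Set.Ico 0 (t : ℝ)) :=
  MemLp.toLp f ((Lp.memLp f).mono_measure (Measure.restrict_mono Set.Ico_subset_Ici_self le_rfl))

/-- The restriction `f|_[t, ∞)`. -/
def after {k : Type u} [NormedAddCommGroup k] (t : ℝ≥0) (f : L2 k (Set.Ici 0)) :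
    L2 k (Set.Ici (t : ℝ)) :=
  MemLp.toLp f ((Lp.memLp f).mono_measure
    (Measure.restrict_mono (Set.Ici_subset_Ici.2 t.coe_nonneg) le_rfl))

theorem coeFn_before {k : Type u} [NormedAddCommGroup k] (t : ℝ≥0) (f : L2 k (Set.Ici 0)) :
    before t f =ᵐ[(volume : Measure ℝ).restrict (Set.Ico 0 (t : ℝ))] f :=
  MemLp.coeFn_toLp _

theorem coeFn_after {k : Type u} [NormedAddCommGroup k] (t : ℝ≥0) (f : L2 k (Set.Ici 0)) :
    after t f =ᵐ[(volume : Measure ℝ).restrict (Set.Ici (t : ℝ))] f :=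
  MemLp.coeFn_toLp _

theorem inner_before_add_inner_after {k : Type u} [NormedAddCommGroup k] [InnerProductSpace ℂ k]
    (t : ℝ≥0) (f g : L2 k (Set.Ici 0)) :
    inner ℂ (before t f) (before t g) + inner ℂ (after t f) (after t g) = inner ℂ f g := by
  have hint : IntegrableOn (fun r => (inner ℂ (f r) (g r) : ℂ)) (Set.Ici 0) volume :=
    L2.integrable_inner f g
  have h1 : (inner ℂ (before t f) (before t g) : ℂ)
      = ∫ r in Set.Ico 0 (t : ℝ), inner ℂ (f r) (g r) := by
    rw [L2.inner_def]
    refine integral_congr_ae ?_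
    filter_upwards [coeFn_before t f, coeFn_before t g] with r hf hg
    rw [hf, hg]
  have h2 : (inner ℂ (after t f) (after t g) : ℂ)
      = ∫ r in Set.Ici (t : ℝ), inner ℂ (f r) (g r) := by
    rw [L2.inner_def]
    refine integral_congr_ae ?_
    filter_upwards [coeFn_after t f, coeFn_after t g] with r hf hg
    rw [hf, hg]
  have hU : Set.Ico 0 (t : ℝ) ∪ Set.Ici (t : ℝ) = Set.Ici 0 :=
    Set.Ico_union_Ici_eq_Ici t.coe_nonneg
  rw [h1, h2, L2.inner_def, ← setIntegral_union _ measurableSet_Ici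
    (hint.mono_set Set.Ico_subset_Ici_self)
    (hint.mono_set (Set.Ici_subset_Ici.2 t.coe_nonneg)), hU]
  rw [Set.disjoint_left]
  intro r hr hr'
  exact absurd hr.2 (not_lt.2 hr')

theorem exists_glue {k : Type u} [NormedAddCommGroup k] (t : ℝ≥0)
    (g : L2 k (Set.Ico 0 (t : ℝ))) (h : L2 k (Set.Ici (t : ℝ))) :
    ∃ f : L2 k (Set.Ici 0), before t f = g ∧ after t f = h := by
  classical
  have hm : MemLp ((Set.Ico 0 (t : ℝ)).piecewise g h) 2 (volume.restrict (Set.Ici 0)) := by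
    refine MemLp.piecewise measurableSet_Ico ?_ ?_
    · rw [Measure.restrict_restrict measurableSet_Ico,
        Set.inter_eq_left.2 Set.Ico_subset_Ici_self]
      exact Lp.memLp g
    · rw [Measure.restrict_restrict measurableSet_Ico.compl]
      refine (Lp.memLp h).mono_measure (Measure.restrict_mono ?_ le_rfl)
      rintro r ⟨hr, hr0⟩
      by_contra hr'
      exact hr ⟨hr0, not_le.1 hr'⟩
  refine ⟨hm.toLp _, ?_, ?_⟩
  · refine Lp.ext ?_
    have hsub : Set.Ico 0 (t : ℝ) ⊆ Set.Ici 0 := Set.Ico_subset_Ici_self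
    have h2 := ae_mono (Measure.restrict_mono (μ := (volume : Measure ℝ)) hsub le_rfl)
      hm.coeFn_toLp
    filter_upwards [coeFn_before t (hm.toLp _), h2, ae_restrict_mem measurableSet_Ico]
      with r h1 h2 hr
    rw [h1, h2, Set.piecewise_eq_of_mem _ _ _ hr]
  · refine Lp.ext ?_
    have h2 := ae_mono (Measure.restrict_mono (μ := (volume : Measure ℝ))
      (Set.Ici_subset_Ici.2 t.coe_nonneg) le_rfl) hm.coeFn_toLp
    filter_upwards [coeFn_after t (hm.toLp _), h2, ae_restrict_mem measurableSet_Ici]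
      with r h1 h2 hr
    rw [h1, h2, Set.piecewise_eq_of_notMem _ _ _ (fun h' => absurd h'.2 (not_lt.2 hr))]

/-- Elementary tensors of members of total families are total. -/
theorem span_htmul {ι κ E F : Type*} [NormedAddCommGroup E] [InnerProductSpace ℂ E]
    [NormedAddCommGroup F] [InnerProductSpace ℂ F] (e : ι → E) (e' : κ → F)
    (he : (Submodule.span ℂ (Set.range e)).topologicalClosure = ⊤)
    (he' : (Submodule.span ℂ (Set.range e')).topologicalClosure = ⊤) :
    (Submodule.span ℂ (Set.range fun p : ι × κ => htmul (e p.1) (e' p.2))).topologicalClosure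
      = ⊤ := by
  set W := (Submodule.span ℂ (Set.range fun p : ι × κ =>
    htmul (e p.1) (e' p.2))).topologicalClosure with hW
  have hcl : IsClosed (W : Set (HTensor E F)) := Submodule.isClosed_topologicalClosure _
  have h1 : ∀ (x : E) (j : κ), htmul x (e' j) ∈ W := by
    intro x j
    let T : E →L[ℂ] HTensor E F :=
      UniformSpace.Completion.toComplL ∘L (TensorProduct.mkL ℂ E F).flip (e' j)
    have hle : (⊤ : Submodule ℂ E) ≤ W.comap T.toLinearMap := by
      rw [← he]
      refine Submodule.topologicalClosure_minimal _ (Submodule.span_le.2 ?_)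
        (hcl.preimage T.continuous)
      rintro _ ⟨i, rfl⟩
      exact Submodule.le_topologicalClosure _ (Submodule.subset_span ⟨(i, j), rfl⟩)
    exact hle (Submodule.mem_top (x := x))
  have h2 : ∀ (x : E) (y : F), htmul x y ∈ W := by
    intro x y
    let T : F →L[ℂ] HTensor E F :=
      UniformSpace.Completion.toComplL ∘L (TensorProduct.mkL ℂ E F) x
    have hle : (⊤ : Submodule ℂ F) ≤ W.comap T.toLinearMap := by
      rw [← he']
      refine Submodule.topologicalClosure_minimal _ (Submodule.span_le.2 ?_)
        (hcl.preimage T.continuous)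
      rintro _ ⟨j, rfl⟩
      exact h1 x j
    exact hle (Submodule.mem_top (x := y))
  rw [Submodule.eq_top_iff']
  intro z
  refine UniformSpace.Completion.induction_on (p := fun z => z ∈ W) z hcl fun w => ?_
  induction w using TensorProduct.induction_on with
  | zero => exact W.zero_mem
  | tmul x y => exact h2 x y
  | add x y hx hy => rw [UniformSpace.Completion.coe_add]; exact W.add_mem hx hy

/-- The tensor-product decomposition with `ε(f) ↔ ε(f|_[0, t)) ⊗ ε(f|_[t, ∞))` exists. -/
theorem exists_split (k : Type u) [NormedAddCommGroup k] [InnerProductSpace ℂ k] (t : ℝ≥0) :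
    ∃ U : FockSpace k ≃ₗᵢ[ℂ] HTensor (FockBefore k t) (FockAfter k t),
      ∀ f, U (expVec f) = htmul (expVec (before t f)) (expVec (after t f)) := by
  obtain ⟨V, hV⟩ := exists_isometry_of_gram (expVec : L2 k (Set.Ici 0) → FockSpace k)
    (fun f => htmul (expVec (before t f)) (expVec (after t f))) (span_expVec _)
    (fun f g => by
      rw [inner_htmul, inner_expVec, inner_expVec, inner_expVec, ← Complex.exp_add,
        inner_before_add_inner_after])
  have hsurj : Function.Surjective V := by
    have hcl : IsClosed
        (SetLike.coe (LinearMap.range V.toLinearMap)) := by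
      rw [LinearMap.coe_range]
      exact V.isometry.isClosedEmbedding.isClosed_range
    have htop := span_htmul (expVec : L2 k (Set.Ico 0 (t : ℝ)) → FockBefore k t)
      (expVec : L2 k (Set.Ici (t : ℝ)) → FockAfter k t) (span_expVec _) (span_expVec _)
    have hle : (⊤ : Submodule ℂ (HTensor (FockBefore k t) (FockAfter k t)))
        ≤ LinearMap.range V.toLinearMap := by
      rw [← htop]
      refine Submodule.topologicalClosure_minimal _ (Submodule.span_le.2 ?_) hcl
      rintro _ ⟨⟨g, h⟩, rfl⟩
      obtain ⟨f, rfl, rfl⟩ := exists_glue t g h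
      exact ⟨expVec f, hV f⟩
    exact fun y => hle (Submodule.mem_top (x := y))
  exact ⟨LinearIsometryEquiv.ofSurjective V hsurj, hV⟩

/-- The decomposition `ε(f) ↔ ε(f|_[0, t)) ⊗ ε(f|_[t, ∞))` of Fock space at time `t`. -/
def split (k : Type u) [NormedAddCommGroup k] [InnerProductSpace ℂ k] (t : ℝ≥0) :
    FockSpace k ≃ₗᵢ[ℂ] HTensor (FockBefore k t) (FockAfter k t) :=
  (exists_split k t).choose

theorem split_expVec (k : Type u) [NormedAddCommGroup k] [InnerProductSpace ℂ k] (t : ℝ≥0)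
    (f : L2 k (Set.Ici 0)) :
    split k t (expVec f) = htmul (expVec (before t f)) (expVec (after t f)) :=
  (exists_split k t).choose_spec f

/-- The vector `u ⊗ v` of Fock space, for `u` before time `t` and `v` after time `t`. -/
def combine {k : Type u} [NormedAddCommGroup k] [InnerProductSpace ℂ k] (t : ℝ≥0)
    (u : FockBefore k t) (v : FockAfter k t) : FockSpace k :=
  (split k t).symm (htmul u v)

theorem measurePreserving_sub (t : ℝ≥0) :
    MeasurePreserving (fun r : ℝ => r - t) ((volume : Measure ℝ).restrict (Set.Ici (t : ℝ)))
      ((volume : Measure ℝ).restrict (Set.Ici 0)) := by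
  have h := (measurePreserving_sub_right (volume : Measure ℝ) (t : ℝ)).restrict_preimage
    (measurableSet_Ici (a := (0 : ℝ)))
  have he : (fun r : ℝ => r - t) ⁻¹' Set.Ici 0 = Set.Ici (t : ℝ) := by
    ext r; simp
  rwa [he] at h

/-- The right shift `f ↦ f(· - t)` from `L²([0, ∞); k)` to `L²([t, ∞); k)`. -/
def shiftInto (k : Type u) [NormedAddCommGroup k] [InnerProductSpace ℂ k] (t : ℝ≥0) :
    L2 k (Set.Ici 0) →ₗᵢ[ℂ] L2 k (Set.Ici (t : ℝ)) :=
  Lp.compMeasurePreservingₗᵢ ℂ (fun r : ℝ => r - t) (measurePreserving_sub t)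

theorem memLp_indicator_after {k : Type u} [NormedAddCommGroup k] (t : ℝ≥0)
    (g : L2 k (Set.Ici (t : ℝ))) :
    MemLp ((Set.Ici (t : ℝ)).indicator g) 2 ((volume : Measure ℝ).restrict (Set.Ici 0)) := by
  rw [memLp_indicator_iff_restrict measurableSet_Ici, Measure.restrict_restrict measurableSet_Ici,
    Set.inter_eq_left.2 (Set.Ici_subset_Ici.2 t.coe_nonneg)]
  exact Lp.memLp g

theorem indicator_ae_eq_after {k : Type u} [NormedAddCommGroup k] (t : ℝ≥0) {g h : ℝ → k}
    (hgh : g =ᵐ[(volume : Measure ℝ).restrict (Set.Ici (t : ℝ))] h) :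
    (Set.Ici (t : ℝ)).indicator g =ᵐ[(volume : Measure ℝ).restrict (Set.Ici 0)]
      (Set.Ici (t : ℝ)).indicator h :=
  ae_restrict_of_ae ((ae_eq_restrict_iff_indicator_ae_eq measurableSet_Ici).1 hgh)

/-- Extension by zero, from `L²([t, ∞); k)` to `L²([0, ∞); k)`. -/
def extendZero (k : Type u) [NormedAddCommGroup k] [InnerProductSpace ℂ k] (t : ℝ≥0) :
    L2 k (Set.Ici (t : ℝ)) →ₗᵢ[ℂ] L2 k (Set.Ici 0) where
  toFun g := (memLp_indicator_after t g).toLp _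
  map_add' g h := by
    rw [← MemLp.toLp_add (memLp_indicator_after t g) (memLp_indicator_after t h),
      MemLp.toLp_eq_toLp_iff, ← Set.indicator_add']
    exact indicator_ae_eq_after t (Lp.coeFn_add g h)
  map_smul' c g := by
    rw [RingHom.id_apply, ← MemLp.toLp_const_smul c (memLp_indicator_after t g),
      MemLp.toLp_eq_toLp_iff]
    refine (indicator_ae_eq_after t (Lp.coeFn_smul c g)).trans (ae_of_all _ fun r => ?_)
    exact Set.indicator_const_smul_apply _ c g r
  norm_map' g := by
    change ‖(memLp_indicator_after t g).toLp _‖ = ‖g‖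
    rw [Lp.norm_toLp, eLpNorm_indicator_eq_eLpNorm_restrict measurableSet_Ici,
      Measure.restrict_restrict measurableSet_Ici,
      Set.inter_eq_left.2 (Set.Ici_subset_Ici.2 t.coe_nonneg), Lp.norm_def]

/-- The isometric right shift `θ_t` on `L²([0, ∞); k)`. -/
def theta (k : Type u) [NormedAddCommGroup k] [InnerProductSpace ℂ k] (t : ℝ≥0) :
    L2 k (Set.Ici 0) →ₗᵢ[ℂ] L2 k (Set.Ici 0) :=
  (extendZero k t).comp (shiftInto k t)

theorem coeFn_theta (k : Type u) [NormedAddCommGroup k] [InnerProductSpace ℂ k] (t : ℝ≥0)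
    (f : L2 k (Set.Ici 0)) :
    theta k t f =ᵐ[(volume : Measure ℝ).restrict (Set.Ici 0)]
      (Set.Ici (t : ℝ)).indicator (fun r => f (r - t)) :=
  (MemLp.coeFn_toLp (memLp_indicator_after t (shiftInto k t f))).trans
    (indicator_ae_eq_after t (Lp.coeFn_compMeasurePreserving f (measurePreserving_sub t)))

/-- The time projection `E_t`: the orthogonal projection onto the closed subspace of vectors
`u ⊗ ε(0|_[t, ∞))`, with `E_∞ = I`. At `t = 0` this is the projection onto `ℂ ε(0)`. -/
def timeProj (k : Type u) [NormedAddCommGroup k] [InnerProductSpace ℂ k] (t : ℝ≥0∞) :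
    FockSpace k →L[ℂ] FockSpace k :=
  if t = ⊤ then ContinuousLinearMap.id ℂ (FockSpace k)
  else (Submodule.span ℂ (Set.range fun u : FockBefore k t.toNNReal =>
    combine t.toNNReal u (expVec 0))).topologicalClosure.starProjection

/-- The second-quantised right shift `Γ_t`, with `ε(f) ↦ ε(θ_t f)` for `t < ∞`, and
`Γ_∞ = E_0`. -/
def shift (k : Type u) [NormedAddCommGroup k] [InnerProductSpace ℂ k] (t : ℝ≥0∞) :
    FockSpace k →L[ℂ] FockSpace k :=
  if t = ⊤ then timeProj k 0 else (secondQuant (theta k t.toNNReal)).toContinuousLinearMap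

/-- The shift `Γ_t`, for `t < ∞`, regarded as a map into Fock space over `L²([t, ∞); k)`. -/
def shiftAfter (k : Type u) [NormedAddCommGroup k] [InnerProductSpace ℂ k] (t : ℝ≥0) :
    FockSpace k →ₗᵢ[ℂ] FockAfter k t :=
  secondQuant (shiftInto k t)

/-- The identification of the two versions of the shift: `Γ_t x = ε(0|_[0, t)) ⊗ Γ_t x`. -/
theorem combine_shiftAfter (k : Type u) [NormedAddCommGroup k] [InnerProductSpace ℂ k] (t : ℝ≥0)
    (x : FockSpace k) : combine t (expVec 0) (shiftAfter k t x) = shift k t x := by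
  have hs : ∀ x, shift k t x = secondQuant (theta k t) x := by
    intro x
    rw [shift, if_neg ENNReal.coe_ne_top, ENNReal.toNNReal_coe]
    rfl
  have hb : ∀ f, before t (theta k t f) = 0 := by
    intro f
    refine Lp.ext ?_
    have hsub : Set.Ico 0 (t : ℝ) ⊆ Set.Ici 0 := Set.Ico_subset_Ici_self
    filter_upwards [coeFn_before t (theta k t f), ae_mono (Measure.restrict_mono
      (μ := (volume : Measure ℝ)) hsub le_rfl) (coeFn_theta k t f), ae_restrict_mem
      measurableSet_Ico, Lp.coeFn_zero k 2 ((volume : Measure ℝ).restrict (Set.Ico 0 (t : ℝ)))]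
      with r h1 h2 hr h0
    have hr' : r ∉ Set.Ici (t : ℝ) := fun h' => absurd hr.2 (not_lt.2 h')
    rw [h1, h2, h0, Set.indicator_of_notMem hr']
    rfl
  have ha : ∀ f, after t (theta k t f) = shiftInto k t f := by
    intro f
    refine Lp.ext ?_
    filter_upwards [coeFn_after t (theta k t f), ae_mono (Measure.restrict_mono
      (μ := (volume : Measure ℝ)) (Set.Ici_subset_Ici.2 t.coe_nonneg) le_rfl)
      (coeFn_theta k t f), ae_restrict_mem measurableSet_Ici,
      Lp.coeFn_compMeasurePreserving f (measurePreserving_sub t)] with r h1 h2 hr h3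
    rw [h1, h2, Set.indicator_of_mem hr]
    exact h3.symm
  rw [hs]
  let T : FockSpace k →L[ℂ] HTensor (FockBefore k t) (FockAfter k t) :=
    UniformSpace.Completion.toComplL ∘L
      ((TensorProduct.mkL ℂ (FockBefore k t) (FockAfter k t)) (expVec 0)) ∘L
        (shiftAfter k t).toContinuousLinearMap
  let T' : FockSpace k →L[ℂ] HTensor (FockBefore k t) (FockAfter k t) :=
    (split k t).toLinearIsometry.toContinuousLinearMap ∘L
      (secondQuant (theta k t)).toContinuousLinearMap
  have hT : T = T' := by
    refine ContinuousLinearMap.ext_on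
      (Submodule.dense_iff_topologicalClosure_eq_top.2 (span_expVec (L2 k (Set.Ici 0)))) ?_
    rintro _ ⟨f, rfl⟩
    change htmul (expVec 0) (secondQuant (shiftInto k t) (expVec f))
      = split k t (secondQuant (theta k t) (expVec f))
    rw [secondQuant_expVec, secondQuant_expVec, split_expVec, hb, ha]
  rw [combine, LinearIsometryEquiv.symm_apply_eq]
  exact congrArg (fun T => T x) hT

/-- A quantum stop time: a spectral measure on the Borel sets of `[0, ∞]`, with values in the
projections on Fock space, which is identity adapted. (The value of `proj` at sets which are not
Borel is irrelevant.) -/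
structure QuantumStopTime (k : Type u) [NormedAddCommGroup k] [InnerProductSpace ℂ k] where
  proj : Set ℝ≥0∞ → (FockSpace k →L[ℂ] FockSpace k)
  isProj : ∀ A, MeasurableSet A → IsStarProjection (proj A)
  isMeasure : ∀ x y : FockSpace k, ∃ μ : ComplexMeasure ℝ≥0∞,
    ∀ A, MeasurableSet A → μ A = inner ℂ x (proj A y)
  univ_eq : proj Set.univ = ContinuousLinearMap.id ℂ (FockSpace k)
  zero_scalar : ∃ c : ℂ, proj {0} = c • ContinuousLinearMap.id ℂ (FockSpace k)
  adapted : ∀ t : ℝ≥0, 0 < t → ∃ T : FockBefore k t →L[ℂ] FockBefore k t,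
    ∀ u v, proj (Set.Icc 0 (t : ℝ≥0∞)) (combine t u v) = combine t (T u) v

/-- A finite quantum stop time: `S({∞}) = 0`, together with the non-triviality requirement
`S({0}) = 0`. -/
def QuantumStopTime.IsFinite {k : Type u} [NormedAddCommGroup k] [InnerProductSpace ℂ k]
    (S : QuantumStopTime k) : Prop :=
  S.proj {0} = 0 ∧ S.proj {⊤} = 0

/-- The finite partitions `{0 = π₀ < ⋯ < πₙ₊₁ = t}` of `[0, t]`, ordered by refinement. -/
abbrev TimePartition (t : ℝ≥0∞) : Type :=
  {π : Finset ℝ≥0∞ // 0 ∈ π ∧ t ∈ π ∧ ∀ s ∈ π, s ≤ t}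

instance (t : ℝ≥0∞) : Nonempty (TimePartition t) :=
  ⟨⟨{0, t}, by simp, by simp, by simp⟩⟩

instance (t : ℝ≥0∞) : IsDirectedOrder (TimePartition t) :=
  ⟨fun π ρ => ⟨⟨π.1 ∪ ρ.1, Finset.mem_union_left _ π.2.1, Finset.mem_union_left _ π.2.2.1,
    fun s hs => (Finset.mem_union.1 hs).elim (π.2.2.2 s) (ρ.2.2.2 s)⟩,
    Finset.subset_union_left, Finset.subset_union_right⟩⟩

/-- The point of the partition which precedes `s`. -/
def TimePartition.pred {t : ℝ≥0∞} (π : TimePartition t) (s : ℝ≥0∞) : ℝ≥0∞ :=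
  (π.1.filter (· < s)).sup id

/-- The Riemann sum `∑_{j=1}^{n+1} S((π_{j-1}, π_j]) v(π_j)`. -/
def stopSum {k : Type u} [NormedAddCommGroup k] [InnerProductSpace ℂ k]
    (S : QuantumStopTime k) {t : ℝ≥0∞} (v : ℝ≥0∞ → FockSpace k) (π : TimePartition t) :
    FockSpace k :=
  ∑ s ∈ π.1.erase 0, S.proj (Set.Ioc (π.pred s) s) (v s)

/-- The stop-time integral `∫_[0, t] S(ds) v(s)` exists, as a limit of Riemann sums as partitions
of `[0, t]` are refined, and equals `y`. -/
def HasStopIntegral {k : Type u} [NormedAddCommGroup k] [InnerProductSpace ℂ k]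
    (S : QuantumStopTime k) (t : ℝ≥0∞) (v : ℝ≥0∞ → FockSpace k) (y : FockSpace k) : Prop :=
  Tendsto (fun π : TimePartition t => stopSum S v π) atTop (𝓝 y)

/-- The integrand `s ↦ ε(f|_[0, s)) ⊗ F_s`, with value `ε(f)` at `s = ∞`. -/
def mixed {k : Type u} [NormedAddCommGroup k] [InnerProductSpace ℂ k]
    (f : L2 k (Set.Ici 0)) (F : (s : ℝ≥0) → FockAfter k s) (s : ℝ≥0∞) : FockSpace k :=
  if s = ⊤ then expVec f else combine s.toNNReal (expVec (before s.toNNReal f)) (F s.toNNReal)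

end CCR
end

namespace CCR

/-! ### The spectral family `S([0, t])` of a stop time. -/

section StopTime

universe u

variable {k : Type u} [NormedAddCommGroup k] [InnerProductSpace ℂ k]

/-! At finite times every integrand in the theorem is `mixedShift f s x`, that is ε(f|_[0,s)) ⊗ Γ_s
x: the case x = ε(0) is E_s ε(f), and the case f = 0 is Γ_s x. Since S({∞}) = 0, the value at ∞ is
immaterial, and an integral over [0, t] is S([0, t]) applied to the one over [0, ∞]. So a single
family, `mixedIntegral f x`, has to be constructed.

Adaptedness drives everything. For c ≤ s the projection S([0, c]) acts only on the factor before s,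
so ⟨S([0, c]) mixedShift f s x, mixedShift g s y⟩ is its value at x = y = ε(0) times ⟨x, y⟩
(`inner_upTo_mixedShift`). As ε(f) is itself `mixedShift f s` of an exponential vector, of norm at
least 1, an increment P = S((a, s]) satisfies ‖P mixedShift f s x‖ ≤ ‖P ε(f)‖ ‖x‖
(`norm_incr_mixedShift_le`). If s ≤ r, then `mixedShift f r x` lies in the range of `mixedShift f
s`, so the change of the integrand from s to r again has this form, with a small argument when r is
near s. Squares add up over the blocks of a partition, and the tail is small because S([0, n]) → I
strongly; hence the Riemann sums are Cauchy (`exists_stopSum_near`).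

The factorisation survives in the limit (`inner_mixedIntegral`). With f = g = 0 it says that Γ_S is
isometric. Comparing with ε(g), the integral of a constant, yields `inner_mixedIntegral_expVec`: the
projection E_S onto the closed span of the vectors `mixedIntegral f (expVec 0)` sends ε(f) to that
vector and commutes with each S([0, t]), so E_{S,t} = S([0, t]) E_S is a projection. The same Gram
identity makes j_S isometric. It is onto by `expVec_mem`: ε(g) is `mixedShift g s` of the
exponential of the left shift of g by s, and freezing that argument on each block of a fine
partition approximates ε(g) by vectors in the range. -/

theorem QuantumStopTime.proj_union (S : QuantumStopTime k) {A B : Set ℝ≥0∞}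
    (hA : MeasurableSet A) (hB : MeasurableSet B) (h : Disjoint A B) :
    S.proj (A ∪ B) = S.proj A + S.proj B := by
  refine ContinuousLinearMap.ext fun y => ext_inner_left ℂ fun x => ?_
  obtain ⟨μ, hμ⟩ := S.isMeasure x y
  rw [add_apply, inner_add_right, ← hμ _ hA, ← hμ _ hB,
    ← hμ _ (hA.union hB), VectorMeasure.of_union h hA hB]

/-- The projection `S([0, t])`. -/
noncomputable def QuantumStopTime.upTo (S : QuantumStopTime k) (t : ℝ≥0∞) :
    FockSpace k →L[ℂ] FockSpace k :=
  S.proj (Set.Icc 0 t)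

theorem QuantumStopTime.isStarProjection_upTo (S : QuantumStopTime k) (t : ℝ≥0∞) :
    IsStarProjection (S.upTo t) :=
  S.isProj _ measurableSet_Icc

theorem QuantumStopTime.upTo_add_Ioc (S : QuantumStopTime k) {a b : ℝ≥0∞} (h : a ≤ b) :
    S.upTo a + S.proj (Set.Ioc a b) = S.upTo b := by
  rw [upTo, upTo, ← S.proj_union measurableSet_Icc measurableSet_Ioc,
    Set.Icc_union_Ioc_eq_Icc zero_le h]
  rw [Set.disjoint_left]
  exact fun s hs hs' => absurd hs.2 (not_le.2 hs'.1)

theorem QuantumStopTime.proj_Ioc (S : QuantumStopTime k) {a b : ℝ≥0∞} (h : a ≤ b) :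
    S.proj (Set.Ioc a b) = S.upTo b - S.upTo a := by
  rw [← S.upTo_add_Ioc h, add_sub_cancel_left]

/-- The sum of these two idempotents is again idempotent, which forces them to anticommute;
anticommuting with an idempotent makes the product vanish. -/
theorem QuantumStopTime.upTo_mul_Ioc (S : QuantumStopTime k) {a b : ℝ≥0∞} (h : a ≤ b) :
    S.upTo a * S.proj (Set.Ioc a b) = 0 ∧ S.proj (Set.Ioc a b) * S.upTo a = 0 := by
  have hP := (S.isStarProjection_upTo a).isIdempotentElem
  have hQ := (S.isProj (Set.Ioc a b) measurableSet_Ioc).isIdempotentElem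
  have hPQ := (S.isStarProjection_upTo b).isIdempotentElem
  rw [← S.upTo_add_Ioc h] at hPQ
  set P := S.upTo a
  set Q := S.proj (Set.Ioc a b)
  have hanti : P * Q + Q * P = 0 := (hP.add_iff hQ).1 hPQ
  have h4 : P * Q = 0 := by
    have : IsAddTorsionFree (FockSpace k →L[ℂ] FockSpace k) := .of_isTorsionFree ℂ _
    exact hP.mul_eq_zero_of_anticommute hanti
  refine ⟨h4, ?_⟩
  rwa [h4, zero_add] at hanti

theorem QuantumStopTime.upTo_upTo (S : QuantumStopTime k) (a b : ℝ≥0∞) (x : FockSpace k) :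
    S.upTo a (S.upTo b x) = S.upTo (min a b) x := by
  have hid : ∀ c y, S.upTo c (S.upTo c y) = S.upTo c y := fun c y =>
    congrArg (fun T => T y) (S.isStarProjection_upTo c).isIdempotentElem.eq
  rcases le_total a b with h | h
  · rw [min_eq_left h, ← S.upTo_add_Ioc h, add_apply, map_add, hid]
    have := congrArg (fun T => T x) (S.upTo_mul_Ioc h).1
    exact add_eq_left.2 this
  · rw [min_eq_right h, ← S.upTo_add_Ioc h, add_apply, hid]
    have := congrArg (fun T => T x) (S.upTo_mul_Ioc h).2
    exact add_eq_left.2 this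

theorem QuantumStopTime.inner_upTo (S : QuantumStopTime k) (a : ℝ≥0∞) (x y : FockSpace k) :
    inner ℂ (S.upTo a x) y = inner ℂ x (S.upTo a y) := by
  rw [← ContinuousLinearMap.adjoint_inner_right,
    ContinuousLinearMap.isSelfAdjoint_iff'.1 (S.isStarProjection_upTo a).isSelfAdjoint]

theorem QuantumStopTime.upTo_top (S : QuantumStopTime k) (x : FockSpace k) : S.upTo ⊤ x = x := by
  have h : Set.Icc (0 : ℝ≥0∞) ⊤ = Set.univ := Set.eq_univ_of_forall fun s => ⟨zero_le, le_top⟩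
  rw [upTo, h, S.univ_eq]
  rfl

theorem QuantumStopTime.IsFinite.upTo_zero {S : QuantumStopTime k} (hS : S.IsFinite)
    (x : FockSpace k) : S.upTo 0 x = 0 := by
  rw [QuantumStopTime.upTo, Set.Icc_self, hS.1]
  rfl

theorem norm_apply_le_of_isStarProjection {H : Type*} [NormedAddCommGroup H]
    [InnerProductSpace ℂ H] [CompleteSpace H] {T : H →L[ℂ] H} (hT : IsStarProjection T) (x : H) :
    ‖T x‖ ≤ ‖x‖ := by
  obtain ⟨_, h⟩ := isStarProjection_iff_eq_starProjection_range.1 hT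
  rw [h]
  exact Submodule.norm_starProjection_apply_le _ x

theorem norm_sq_eq_inner_of_isStarProjection {H : Type*} [NormedAddCommGroup H]
    [InnerProductSpace ℂ H] [CompleteSpace H] {T : H →L[ℂ] H} (hT : IsStarProjection T) (x : H) :
    ((‖T x‖ ^ 2 : ℝ) : ℂ) = inner ℂ x (T x) := by
  have h1 : inner ℂ (T x) (T x) = inner ℂ x (T (T x)) := by
    rw [← ContinuousLinearMap.adjoint_inner_right,
      ContinuousLinearMap.isSelfAdjoint_iff'.1 hT.isSelfAdjoint]
  have h2 : T (T x) = T x := congrArg (fun T => T x) hT.isIdempotentElem.eq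
  rw [h2, inner_self_eq_norm_sq_to_K] at h1
  exact_mod_cast h1

theorem iInter_Ioc_natCast_top : (⋂ n : ℕ, Set.Ioc (n : ℝ≥0∞) ⊤) = {⊤} := by
  ext s
  simp only [Set.mem_iInter, Set.mem_Ioc, le_top, and_true, Set.mem_singleton_iff]
  refine ⟨fun h => ?_, fun h n => h ▸ ENNReal.natCast_lt_top n⟩
  by_contra hs
  obtain ⟨n, hn⟩ := ENNReal.exists_nat_gt hs
  exact absurd hn (h n).not_gt

/-- `S([0, n])` converges strongly to the identity when `S({∞}) = 0`. -/
theorem QuantumStopTime.IsFinite.tendsto_upTo {S : QuantumStopTime k} (hS : S.IsFinite)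
    (x : FockSpace k) : Tendsto (fun n : ℕ => S.upTo n x) atTop (𝓝 x) := by
  obtain ⟨μ, hμ⟩ := S.isMeasure x x
  -- The squared distance is the scalar spectral measure of (n, ∞], so continuity from above reduces
  -- the claim to S({∞}) = 0.
  have h3 : ∀ n : ℕ, ‖S.upTo n x - x‖ = √‖μ (Set.Ioc (n : ℝ≥0∞) ⊤)‖ := by
    intro n
    have h := norm_sq_eq_inner_of_isStarProjection
      (S.isProj (Set.Ioc (n : ℝ≥0∞) ⊤) measurableSet_Ioc) x
    rw [hμ _ measurableSet_Ioc, ← h, Complex.norm_real, Real.norm_of_nonneg (sq_nonneg _),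
      Real.sqrt_sq (norm_nonneg _), S.proj_Ioc le_top, sub_apply, S.upTo_top, norm_sub_rev]
  have h0 : μ (⋂ n : ℕ, Set.Ioc (n : ℝ≥0∞) ⊤) = 0 := by
    rw [iInter_Ioc_natCast_top, hμ _ (measurableSet_singleton _), hS.2, zero_apply,
      inner_zero_right]
  have h1 : Tendsto (fun n : ℕ => μ (Set.Ioc (n : ℝ≥0∞) ⊤)) atTop (𝓝 0) := by
    rw [← h0]
    exact VectorMeasure.tendsto_vectorMeasure_iInter_atTop_nat
      (fun i j hij => Set.Ioc_subset_Ioc_left (Nat.cast_le.2 hij)) (fun n => measurableSet_Ioc)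
  rw [tendsto_iff_norm_sub_tendsto_zero]
  simp_rw [h3]
  have h4 := (Real.continuous_sqrt.tendsto _).comp h1.norm
  rwa [norm_zero, Real.sqrt_zero] at h4

theorem QuantumStopTime.IsFinite.exists_upTo_near {S : QuantumStopTime k} (hS : S.IsFinite)
    (x : FockSpace k) {η : ℝ} (hη : 0 < η) :
    ∃ b : ℝ≥0, ‖x - S.upTo b x‖ < η := by
  have h := (Metric.tendsto_atTop.1 (hS.tendsto_upTo x) η hη)
  obtain ⟨N, hN⟩ := h
  refine ⟨N, ?_⟩
  have := hN N le_rfl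
  rwa [dist_eq_norm, norm_sub_rev] at this

/-! ### Partitions, increments and Riemann sums. -/

theorem TimePartition.pred_le {t : ℝ≥0∞} (π : TimePartition t) (s : ℝ≥0∞) : π.pred s ≤ s :=
  Finset.sup_le fun _ hr => (Finset.mem_filter.1 hr).2.le

theorem TimePartition.le_pred {t : ℝ≥0∞} (π : TimePartition t) {r s : ℝ≥0∞} (hr : r ∈ π.1)
    (h : r < s) : r ≤ π.pred s :=
  Finset.le_sup (f := id) (Finset.mem_filter.2 ⟨hr, h⟩)

theorem TimePartition.pred_mem {t : ℝ≥0∞} (π : TimePartition t) {s : ℝ≥0∞} (hs : s ≠ 0) :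
    π.pred s ∈ π.1 ∧ π.pred s < s := by
  have hne : (π.1.filter (· < s)).Nonempty :=
    ⟨0, Finset.mem_filter.2 ⟨π.2.1, pos_iff_ne_zero.2 hs⟩⟩
  obtain ⟨r, hr, h⟩ := Finset.exists_mem_eq_sup _ hne id
  obtain ⟨h1, h2⟩ := Finset.mem_filter.1 hr
  exact (show π.pred s = r from h) ▸ ⟨h1, h2⟩

theorem TimePartition.exists_next {t : ℝ≥0∞} (π : TimePartition t) {s : ℝ≥0∞} (hs : s ≤ t) :
    ∃ r ∈ π.1, s ≤ r ∧ ∀ r' ∈ π.1, s ≤ r' → r ≤ r' := by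
  classical
  have hne : (π.1.filter fun r => s ≤ r).Nonempty := ⟨t, Finset.mem_filter.2 ⟨π.2.2.1, hs⟩⟩
  have h := Finset.mem_filter.1 ((π.1.filter fun r => s ≤ r).min'_mem hne)
  exact ⟨_, h.1, h.2, fun r' hr' h' => Finset.min'_le _ _ (Finset.mem_filter.2 ⟨hr', h'⟩)⟩

/-- The increment `S((π_{j-1}, π_j])` at `s = π_j`. -/
noncomputable def QuantumStopTime.incr (S : QuantumStopTime k) {t : ℝ≥0∞} (π : TimePartition t)
    (s : ℝ≥0∞) : FockSpace k →L[ℂ] FockSpace k :=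
  S.proj (Set.Ioc (π.pred s) s)

theorem QuantumStopTime.incr_apply (S : QuantumStopTime k) {t : ℝ≥0∞} (π : TimePartition t)
    (s : ℝ≥0∞) (x : FockSpace k) :
    S.incr π s x = S.upTo s x - S.upTo (π.pred s) x := by
  rw [incr, S.proj_Ioc (π.pred_le s), sub_apply]

theorem QuantumStopTime.isStarProjection_incr (S : QuantumStopTime k) {t : ℝ≥0∞}
    (π : TimePartition t) (s : ℝ≥0∞) : IsStarProjection (S.incr π s) :=
  S.isProj _ measurableSet_Ioc

theorem QuantumStopTime.inner_incr (S : QuantumStopTime k) {t : ℝ≥0∞} (π : TimePartition t)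
    (s : ℝ≥0∞) (x y : FockSpace k) : inner ℂ (S.incr π s x) y = inner ℂ x (S.incr π s y) := by
  rw [← ContinuousLinearMap.adjoint_inner_right,
    ContinuousLinearMap.isSelfAdjoint_iff'.1 (S.isStarProjection_incr π s).isSelfAdjoint]

theorem stopSum_eq (S : QuantumStopTime k) {t : ℝ≥0∞} (v : ℝ≥0∞ → FockSpace k)
    (π : TimePartition t) : stopSum S v π = ∑ s ∈ π.1.erase 0, S.incr π s (v s) := rfl

/-- As π refines π₀, the block of π ending at s is either contained in the block of π₀ ending at r
or disjoint from it; the condition separates the two cases. -/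
theorem QuantumStopTime.incr_incr (S : QuantumStopTime k) {t t' : ℝ≥0∞} {π₀ : TimePartition t'}
    {π : TimePartition t} (h : π₀.1 ⊆ π.1) {s r : ℝ≥0∞} (hr : r ∈ π₀.1)
    (hr0 : r ≠ 0) (x : FockSpace k) :
    S.incr π s (S.incr π₀ r x) = if π₀.pred r < s ∧ s ≤ r then S.incr π s x else 0 := by
  simp only [incr_apply, map_sub, upTo_upTo]
  have hp := π₀.pred_mem hr0
  have hps := π.pred_le s
  split_ifs with hc
  · have h1 : π₀.pred r ≤ π.pred s := π.le_pred (h hp.1) hc.1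
    rw [min_eq_left hc.2, min_eq_right hc.1.le, min_eq_left (hps.trans hc.2), min_eq_right h1]
    abel
  · rcases not_and_or.1 hc with hc | hc
    · have hc := not_lt.1 hc
      have hsr := hc.trans hp.2.le
      rw [min_eq_left hsr, min_eq_left hc, min_eq_left (hps.trans hsr), min_eq_left (hps.trans hc)]
      abel
    · have hc := not_le.1 hc
      have h1 : r ≤ π.pred s := π.le_pred (h hr) hc
      rw [min_eq_right hc.le, min_eq_right (hp.2.le.trans hc.le), min_eq_right h1,
        min_eq_right (hp.2.le.trans h1)]
      abel

theorem QuantumStopTime.incr_upTo (S : QuantumStopTime k) {t : ℝ≥0∞} (π : TimePartition t)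
    {s b : ℝ≥0∞} (hb : b ∈ π.1) (x : FockSpace k) :
    S.incr π s (S.upTo b x) = if s ≤ b then S.incr π s x else 0 := by
  simp only [incr_apply, upTo_upTo]
  split_ifs with h
  · rw [min_eq_left h, min_eq_left ((π.pred_le s).trans h)]
  · rw [min_eq_right (not_le.1 h).le, min_eq_right (π.le_pred hb (not_le.1 h)), sub_self]

theorem QuantumStopTime.upTo_incr (S : QuantumStopTime k) {t : ℝ≥0∞} (π : TimePartition t)
    (s b : ℝ≥0∞) (x : FockSpace k) :
    S.upTo b (S.incr π s x) = S.incr π s (S.upTo b x) := by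
  simp only [incr_apply, upTo_upTo, map_sub, min_comm]

/-- On a refinement `π` of `π₀`, the Riemann sum over `π₀` is that of the integrand sampled at the
next point of `π₀`. -/
theorem incr_stopSum (S : QuantumStopTime k) {t t' : ℝ≥0∞} {π₀ : TimePartition t'}
    {π : TimePartition t} (h : π₀.1 ⊆ π.1) (v : ℝ≥0∞ → FockSpace k) {s r : ℝ≥0∞}
    (hs0 : s ≠ 0) (hr : r ∈ π₀.1) (hsr : s ≤ r) (hmin : ∀ r' ∈ π₀.1, s ≤ r' → r ≤ r') :
    S.incr π s (stopSum S v π₀) = S.incr π s (v r) := by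
  have hr0 : r ≠ 0 := fun h => hs0 (le_zero_iff.1 (h ▸ hsr))
  rw [stopSum_eq, map_sum, Finset.sum_eq_single r]
  · rw [S.incr_incr h hr hr0, if_pos]
    refine ⟨?_, hsr⟩
    by_contra hc
    exact absurd (hmin _ (π₀.pred_mem hr0).1 (not_lt.1 hc)) (π₀.pred_mem hr0).2.not_ge
  · intro b hb hbr
    obtain ⟨hb0, hb⟩ := Finset.mem_erase.1 hb
    rw [S.incr_incr h hb hb0, if_neg]
    rintro ⟨h1, h2⟩
    have h3 : r < b := lt_of_le_of_ne (hmin b hb h2) hbr.symm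
    exact absurd (hsr.trans (π₀.le_pred hr h3)) h1.not_ge
  · exact fun h' => absurd (Finset.mem_erase.2 ⟨hr0, hr⟩) h'

theorem incr_stopSum_self (S : QuantumStopTime k) {t : ℝ≥0∞}
    (π : TimePartition t) (v : ℝ≥0∞ → FockSpace k) {s : ℝ≥0∞} (hs : s ∈ π.1)
    (hs0 : s ≠ 0) : S.incr π s (stopSum S v π) = S.incr π s (v s) :=
  incr_stopSum S subset_rfl v hs0 hs le_rfl fun _ _ h => h

/-- The increments telescope. The induction runs on the number of partition points below b and peels
off the block ending at b; the bottom term S({0}) vanishes because the stop time is finite. -/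
theorem QuantumStopTime.IsFinite.sum_incr_le {S : QuantumStopTime k} (hS : S.IsFinite) {t : ℝ≥0∞}
    (π : TimePartition t) (x : FockSpace k) {b : ℝ≥0∞} (hb : b ∈ π.1) :
    ∑ s ∈ (π.1.erase 0).filter (· ≤ b), S.incr π s x = S.upTo b x := by
  induction hn : (π.1.filter (· < b)).card using Nat.strong_induction_on generalizing b with
  | _ n ih =>
  rcases eq_or_ne b 0 with rfl | hb0
  · rw [hS.upTo_zero]
    refine Finset.sum_eq_zero fun s hs => ?_
    obtain ⟨h1, h2⟩ := Finset.mem_filter.1 hs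
    exact absurd (le_zero_iff.1 h2) (Finset.mem_erase.1 h1).1
  · have hp := π.pred_mem hb0
    have hlt : (π.1.filter (· < π.pred b)).card < n := by
      rw [← hn]
      refine Finset.card_lt_card (Finset.ssubset_iff_of_subset ?_ |>.2 ⟨π.pred b, ?_, ?_⟩)
      · exact Finset.monotone_filter_right _ fun s _ hs => lt_trans hs hp.2
      · exact Finset.mem_filter.2 hp
      · simp
    have hset : (π.1.erase 0).filter (· ≤ b)
        = insert b ((π.1.erase 0).filter (· ≤ π.pred b)) := by
      ext s
      simp only [Finset.mem_filter, Finset.mem_erase, Finset.mem_insert]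
      constructor
      · rintro ⟨⟨h0, h1⟩, h2⟩
        rcases h2.eq_or_lt with h | h
        · exact Or.inl h
        · exact Or.inr ⟨⟨h0, h1⟩, π.le_pred h1 h⟩
      · rintro (rfl | ⟨h1, h2⟩)
        · exact ⟨⟨hb0, hb⟩, le_rfl⟩
        · exact ⟨h1, h2.trans hp.2.le⟩
    rw [hset, Finset.sum_insert, ih _ hlt hp.1 rfl, S.incr_apply, sub_add_cancel]
    exact fun h => absurd (Finset.mem_filter.1 h).2 hp.2.not_ge

theorem QuantumStopTime.IsFinite.stopSum_const {S : QuantumStopTime k} (hS : S.IsFinite)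
    (π : TimePartition ⊤) (x : FockSpace k) : stopSum S (fun _ => x) π = x := by
  have h := hS.sum_incr_le π x π.2.2.1
  rw [S.upTo_top, Finset.filter_true_of_mem fun _ _ => le_top] at h
  exact h

/-- Pythagoras: the increments are projections with sum I, so ‖Px‖² = ⟨x, Px⟩ can be summed. -/
theorem QuantumStopTime.IsFinite.sum_norm_incr_sq {S : QuantumStopTime k} (hS : S.IsFinite)
    (π : TimePartition ⊤) (x : FockSpace k) :
    ∑ s ∈ π.1.erase 0, ‖S.incr π s x‖ ^ 2 = ‖x‖ ^ 2 := by
  apply Complex.ofReal_injective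
  push_cast
  have h : (∑ s ∈ π.1.erase 0, inner ℂ x (S.incr π s x)) = (inner ℂ x x : ℂ) := by
    rw [← inner_sum]
    exact congrArg _ (hS.stopSum_const π x)
  rw [inner_self_eq_norm_sq_to_K] at h
  refine Eq.trans (Finset.sum_congr rfl fun s _ => ?_) h
  rw [← norm_sq_eq_inner_of_isStarProjection (S.isStarProjection_incr π s)]
  push_cast
  rfl

/-- Reassembles blockwise estimates. In the applications `w` is an exponential vector, weighted by
the squared mesh error, and `w'` is its tail beyond a large time. -/
theorem QuantumStopTime.IsFinite.norm_sq_le_of_incr {S : QuantumStopTime k} (hS : S.IsFinite)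
    (π : TimePartition ⊤) (y w w' : FockSpace k) (η C : ℝ)
    (h : ∀ s ∈ π.1, s ≠ 0 →
      ‖S.incr π s y‖ ^ 2 ≤ η * ‖S.incr π s w‖ ^ 2 + C * ‖S.incr π s w'‖ ^ 2) :
    ‖y‖ ^ 2 ≤ η * ‖w‖ ^ 2 + C * ‖w'‖ ^ 2 := by
  rw [← hS.sum_norm_incr_sq π y, ← hS.sum_norm_incr_sq π w, ← hS.sum_norm_incr_sq π w',
    Finset.mul_sum, Finset.mul_sum, ← Finset.sum_add_distrib]
  exact Finset.sum_le_sum fun s hs => h s (Finset.mem_erase.1 hs).2 (Finset.mem_erase.1 hs).1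

/-- Off-diagonal terms drop out because distinct blocks are orthogonal. Both remaining cut-offs are
at most s, which is the range where adaptedness gives information about the integrand at time s. -/
theorem inner_upTo_stopSum (S : QuantumStopTime k) {t : ℝ≥0∞} (π : TimePartition t)
    (c : ℝ≥0∞) (v w : ℝ≥0∞ → FockSpace k) :
    inner ℂ (S.upTo c (stopSum S v π)) (stopSum S w π)
      = ∑ s ∈ π.1.erase 0, (inner ℂ (S.upTo (min c s) (v s)) (w s)
          - inner ℂ (S.upTo (min c (π.pred s)) (v s)) (w s) : ℂ) := by
  rw [stopSum_eq S w, inner_sum]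
  refine Finset.sum_congr rfl fun s hs => ?_
  obtain ⟨hs0, hs⟩ := Finset.mem_erase.1 hs
  rw [← S.inner_incr, ← S.upTo_incr, incr_stopSum_self S π v hs hs0, S.incr_apply, map_sub,
    S.upTo_upTo, S.upTo_upTo, inner_sub_left]

/-- A proportionality of the matrix elements of adapted integrands passes to their integrals. -/
theorem inner_upTo_stopIntegral {S : QuantumStopTime k} {v w v' w' : ℝ≥0∞ → FockSpace k}
    {y z y' z' : FockSpace k} {t : ℝ≥0∞} (κ : ℂ)
    (hv : HasStopIntegral S t v y) (hw : HasStopIntegral S t w z)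
    (hv' : HasStopIntegral S t v' y') (hw' : HasStopIntegral S t w' z')
    (h : ∀ s c, c ≤ s →
      inner ℂ (S.upTo c (v s)) (w s) = inner ℂ (S.upTo c (v' s)) (w' s) * κ) (c : ℝ≥0∞) :
    inner ℂ (S.upTo c y) z = inner ℂ (S.upTo c y') z' * κ := by
  have h1 : ∀ {v w y z}, HasStopIntegral S t v y → HasStopIntegral S t w z →
      Tendsto (fun π : TimePartition t =>
        (inner ℂ (S.upTo c (stopSum S v π)) (stopSum S w π) : ℂ)) atTop
        (𝓝 (inner ℂ (S.upTo c y) z)) := fun hv hw =>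
    (((S.upTo c).continuous.tendsto _).comp hv).inner hw
  refine tendsto_nhds_unique (h1 hv hw) (((h1 hv' hw').mul_const κ).congr fun π => ?_)
  rw [inner_upTo_stopSum, inner_upTo_stopSum, Finset.sum_mul]
  refine Finset.sum_congr rfl fun s _ => ?_
  rw [h _ _ (min_le_right _ _), h _ _ ((min_le_right _ _).trans (π.pred_le s)), sub_mul]

theorem QuantumStopTime.IsFinite.hasStopIntegral_const {S : QuantumStopTime k} (hS : S.IsFinite)
    (x : FockSpace k) : HasStopIntegral S ⊤ (fun _ => x) x := by
  unfold HasStopIntegral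
  simp_rw [hS.stopSum_const]
  exact tendsto_const_nhds

/-- Partitions may be refined by a given finite set. -/
theorem exists_timePartition_top (A : Finset ℝ≥0) :
    ∃ π : TimePartition ⊤, π.1 = insert 0 (insert ⊤ (A.image ((↑) : ℝ≥0 → ℝ≥0∞))) :=
  ⟨⟨insert 0 (insert ⊤ (A.image ((↑) : ℝ≥0 → ℝ≥0∞))), by simp, by simp, fun _ _ => le_top⟩, rfl⟩

/-- The value of an integrand at `∞` does not influence the integral. -/
theorem QuantumStopTime.IsFinite.hasStopIntegral_congr {S : QuantumStopTime k} (hS : S.IsFinite)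
    {v w : ℝ≥0∞ → FockSpace k} (h : ∀ s, s ≠ ⊤ → v s = w s) {y : FockSpace k}
    (hv : HasStopIntegral S ⊤ v y) : HasStopIntegral S ⊤ w y := by
  have hd : ∀ π : TimePartition ⊤, stopSum S w π
      = stopSum S v π + S.incr π ⊤ (w ⊤ - v ⊤) := by
    intro π
    have hmem : (⊤ : ℝ≥0∞) ∈ π.1.erase 0 := Finset.mem_erase.2 ⟨ENNReal.top_ne_zero, π.2.2.1⟩
    rw [← sub_eq_iff_eq_add', stopSum_eq, stopSum_eq, ← Finset.sum_sub_distrib,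
      Finset.sum_eq_single ⊤]
    · rw [map_sub]
    · intro s _ hs
      rw [h s hs, sub_self]
    · exact fun h' => absurd hmem h'
  -- Only the last block sees the change at ∞. Once the partition contains b, that block lies in (b,
  -- ∞], where S is small on the given vector.
  have h0 : Tendsto (fun π : TimePartition ⊤ => S.incr π ⊤ (w ⊤ - v ⊤)) atTop (𝓝 0) := by
    generalize w ⊤ - v ⊤ = z
    rw [Metric.tendsto_nhds]
    intro η hη
    obtain ⟨b, hb⟩ := hS.exists_upTo_near z hη
    obtain ⟨π₀, hπ₀⟩ := exists_timePartition_top {b}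
    filter_upwards [eventually_ge_atTop π₀] with π hπ
    have hbπ : (b : ℝ≥0∞) ∈ π.1 := hπ (by simp [hπ₀])
    rw [dist_zero_right]
    have h1 : S.incr π ⊤ z = S.incr π ⊤ (z - S.upTo b z) := by
      rw [map_sub, S.incr_upTo π hbπ, if_neg (by simp), sub_zero]
    rw [h1]
    exact (norm_apply_le_of_isStarProjection (S.isStarProjection_incr π ⊤) _).trans_lt hb
  unfold HasStopIntegral
  simp_rw [hd]
  simpa using Tendsto.add hv h0

/-- The restriction of a partition of `[0, ∞]` to `[0, t]`. -/
noncomputable def TimePartition.restrict (t : ℝ≥0∞) (π : TimePartition ⊤) : TimePartition t :=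
  ⟨insert t (π.1.filter (· ≤ t)), by simp [π.2.1], by simp, by simp⟩

/-- Lets a limit over partitions of [0, t] be computed along restrictions of partitions of [0, ∞].
-/
theorem TimePartition.tendsto_restrict (t : ℝ≥0∞) :
    map (TimePartition.restrict t) atTop = atTop := by
  refine le_antisymm ?_ ?_
  · refine tendsto_atTop.2 fun π => ?_
    refine (eventually_ge_atTop (⟨insert ⊤ π.1, by simp [π.2.1], by simp, fun _ _ => le_top⟩ :
      TimePartition ⊤)).mono fun ρ hρ s hs => ?_
    exact Finset.mem_insert_of_mem (Finset.mem_filter.2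
      ⟨hρ (Finset.mem_insert_of_mem hs), π.2.2.2 s hs⟩)
  · intro U hU
    obtain ⟨ρ, hρ⟩ := mem_atTop_sets.1 (mem_map.1 hU)
    -- Any π finer than the restriction of ρ is itself the restriction of ρ ∪ π, a refinement of ρ.
    refine mem_atTop_sets.2 ⟨ρ.restrict t, fun π hπ => ?_⟩
    have h := hρ ⟨ρ.1 ∪ π.1, by simp [ρ.2.1], by simp [ρ.2.2.1], fun _ _ => le_top⟩
      Finset.subset_union_left
    have he : TimePartition.restrict t (⟨ρ.1 ∪ π.1, by simp [ρ.2.1], by simp [ρ.2.2.1],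
        fun _ _ => le_top⟩ : TimePartition ⊤) = π := by
      refine Subtype.ext (Finset.ext fun s => ?_)
      simp only [restrict, Finset.mem_insert, Finset.mem_filter, Finset.mem_union]
      constructor
      · rintro (rfl | ⟨h1 | h1, h2⟩)
        · exact π.2.2.1
        · exact hπ (Finset.mem_insert_of_mem (Finset.mem_filter.2 ⟨h1, h2⟩))
        · exact h1
      · exact fun hs => Or.inr ⟨Or.inr hs, π.2.2.2 s hs⟩
    rwa [Set.mem_preimage, he] at h

/-- With t a partition point, each block lies inside [0, t] or is disjoint from it, so S([0, t])
simply truncates the sum. -/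
theorem upTo_stopSum (S : QuantumStopTime k) {t : ℝ≥0∞} (π : TimePartition ⊤) (ht : t ∈ π.1)
    (v : ℝ≥0∞ → FockSpace k) :
    S.upTo t (stopSum S v π) = stopSum S v (π.restrict t) := by
  have hset : (π.restrict t).1 = π.1.filter (· ≤ t) :=
    Finset.insert_eq_of_mem (Finset.mem_filter.2 ⟨ht, le_rfl⟩)
  rw [stopSum_eq, stopSum_eq, map_sum, hset, ← Finset.filter_erase, Finset.sum_filter]
  refine Finset.sum_congr rfl fun s hs => ?_
  rw [S.upTo_incr, S.incr_upTo π ht]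
  refine ite_congr rfl (fun h => ?_) fun _ => rfl
  have hp : (π.restrict t).pred s = π.pred s := by
    rw [TimePartition.pred, TimePartition.pred, hset, Finset.filter_filter]
    congr 1
    exact Finset.filter_congr fun r _ => ⟨fun h => h.2, fun hr => ⟨hr.le.trans h, hr⟩⟩
  rw [QuantumStopTime.incr, QuantumStopTime.incr, hp]

/-- The integral over `[0, t]` is `S([0, t])` applied to the integral over `[0, ∞]`. -/
theorem HasStopIntegral.upTo {S : QuantumStopTime k} {v : ℝ≥0∞ → FockSpace k} {y : FockSpace k}
    (h : HasStopIntegral S ⊤ v y) (t : ℝ≥0∞) : HasStopIntegral S t v (S.upTo t y) := by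
  unfold HasStopIntegral
  rw [← TimePartition.tendsto_restrict t, tendsto_map'_iff]
  refine (((S.upTo t).continuous.tendsto y).comp h).congr' ?_
  filter_upwards [eventually_ge_atTop (⟨{0, t, ⊤}, by simp, by simp, fun _ _ => le_top⟩ :
    TimePartition ⊤)] with π hπ
  exact upTo_stopSum S π (hπ (by simp)) v

end StopTime

/-! ### Shifts on L² and concatenation of functions. -/

section Shift

universe u

variable {k : Type u} [NormedAddCommGroup k]

theorem L2.ext_before_after {t : ℝ≥0} {f g : L2 k (Set.Ici 0)} (h1 : before t f = before t g)
    (h2 : after t f = after t g) : f = g := by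
  refine Lp.ext ?_
  have hU : Set.Ici 0 = Set.Ico 0 (t : ℝ) ∪ Set.Ici (t : ℝ) :=
    (Set.Ico_union_Ici_eq_Ici t.coe_nonneg).symm
  refine (congrArg (fun A => ∀ᵐ r ∂(volume : Measure ℝ).restrict A, f r = g r) hU).mpr ?_
  refine (ae_restrict_union_iff _ _ _).2 ⟨?_, ?_⟩
  · filter_upwards [coeFn_before t f, coeFn_before t g] with r hf hg
    rw [← hf, ← hg, h1]
  · filter_upwards [coeFn_after t f, coeFn_after t g] with r hf hg
    rw [← hf, ← hg, h2]

theorem before_eq_of_le {s t : ℝ≥0} (hst : s ≤ t) {f g : L2 k (Set.Ici 0)}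
    (h : before t f = before t g) : before s f = before s g := by
  have hsub : Set.Ico 0 (s : ℝ) ⊆ Set.Ico 0 (t : ℝ) :=
    Set.Ico_subset_Ico_right (NNReal.coe_le_coe.2 hst)
  have hm := Measure.restrict_mono (μ := (volume : Measure ℝ)) hsub le_rfl
  refine Lp.ext ?_
  filter_upwards [coeFn_before s f, coeFn_before s g, ae_mono hm (coeFn_before t f),
    ae_mono hm (coeFn_before t g)] with r h1 h2 h3 h4
  rw [h1, h2, ← h3, ← h4, h]

theorem before_add (t : ℝ≥0) (f g : L2 k (Set.Ici 0)) :
    before t (f + g) = before t f + before t g := by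
  refine Lp.ext ?_
  filter_upwards [coeFn_before t f, coeFn_before t g, coeFn_before t (f + g),
    Lp.coeFn_add (before t f) (before t g), ae_mono (Measure.restrict_mono
      (μ := (volume : Measure ℝ)) Set.Ico_subset_Ici_self le_rfl) (Lp.coeFn_add f g)]
    with r h1 h2 h3 h4 h5
  rw [h3, h4, h5, Pi.add_apply, Pi.add_apply, h1, h2]

theorem before_zero (t : ℝ≥0) : before t (0 : L2 k (Set.Ici 0)) = 0 := by
  have := before_add t (0 : L2 k (Set.Ici 0)) 0
  rwa [add_zero, left_eq_add] at this

theorem after_add (t : ℝ≥0) (f g : L2 k (Set.Ici 0)) :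
    after t (f + g) = after t f + after t g := by
  refine Lp.ext ?_
  filter_upwards [coeFn_after t f, coeFn_after t g, coeFn_after t (f + g),
    Lp.coeFn_add (after t f) (after t g), ae_mono (Measure.restrict_mono
      (μ := (volume : Measure ℝ)) (Set.Ici_subset_Ici.2 t.coe_nonneg) le_rfl) (Lp.coeFn_add f g)]
    with r h1 h2 h3 h4 h5
  rw [h3, h4, h5, Pi.add_apply, Pi.add_apply, h1, h2]

theorem measurePreserving_add (t : ℝ≥0) :
    MeasurePreserving (fun r : ℝ => r + t) ((volume : Measure ℝ).restrict (Set.Ici 0))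
      ((volume : Measure ℝ).restrict (Set.Ici (t : ℝ))) := by
  have h := (measurePreserving_add_right (volume : Measure ℝ) (t : ℝ)).restrict_preimage
    (measurableSet_Ici (a := (t : ℝ)))
  have he : (fun r : ℝ => r + t) ⁻¹' Set.Ici (t : ℝ) = Set.Ici 0 := by
    ext r; simp
  rwa [he] at h

/-- The left shift `f ↦ f(· + t)` on `L²([0, ∞); k)`. -/
noncomputable def leftShift (t : ℝ≥0) (f : L2 k (Set.Ici 0)) : L2 k (Set.Ici 0) :=
  Lp.compMeasurePreserving (fun r : ℝ => r + t) (measurePreserving_add t) (after t f)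

theorem coeFn_leftShift (t : ℝ≥0) (f : L2 k (Set.Ici 0)) :
    leftShift t f =ᵐ[(volume : Measure ℝ).restrict (Set.Ici 0)] fun r => f (r + t) :=
  (Lp.coeFn_compMeasurePreserving (after t f) (measurePreserving_add t)).trans
    ((measurePreserving_add t).quasiMeasurePreserving.ae_eq_comp (coeFn_after t f))

theorem memLp_indicator_Ici (f : L2 k (Set.Ici 0)) :
    MemLp ((Set.Ici (0 : ℝ)).indicator f) 2 volume :=
  (memLp_indicator_iff_restrict measurableSet_Ici).2 (Lp.memLp f)

/-- The extension by zero of `f ∈ L²([0, ∞); k)`, translated by `t`. -/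
noncomputable def translate (f : L2 k (Set.Ici 0)) (t : ℝ) : Lp k 2 (volume : Measure ℝ) :=
  Lp.compMeasurePreserving (ContinuousMap.id ℝ - ContinuousMap.const ℝ t)
    (measurePreserving_sub_right volume t) ((memLp_indicator_Ici f).toLp _)

theorem coeFn_translate (f : L2 k (Set.Ici 0)) (t : ℝ) :
    translate f t =ᵐ[volume] fun r => (Set.Ici (0 : ℝ)).indicator f (r - t) :=
  (Lp.coeFn_compMeasurePreserving _ (measurePreserving_sub_right volume t)).trans
    ((measurePreserving_sub_right volume t).quasiMeasurePreserving.ae_eq_comp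
      (memLp_indicator_Ici f).coeFn_toLp)

/-- Strong continuity of translations, available because the exponent 2 is finite. On the whole line
translations of either sign preserve the measure, so this serves both the right and the left shift.
-/
theorem continuous_translate (f : L2 k (Set.Ici 0)) : Continuous (translate f) :=
  Continuous.compMeasurePreservingLp continuous_const
    (continuous_const.sub ContinuousMap.continuous_const')
    (fun t => measurePreserving_sub_right volume t) ENNReal.ofNat_ne_top

variable [InnerProductSpace ℂ k]

theorem before_theta (t : ℝ≥0) (f : L2 k (Set.Ici 0)) : before t (theta k t f) = 0 := by
  refine Lp.ext ?_
  filter_upwards [coeFn_before t (theta k t f), ae_mono (Measure.restrict_mono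
    (μ := (volume : Measure ℝ)) (Set.Ico_subset_Ici_self : Set.Ico 0 (t : ℝ) ⊆ Set.Ici 0) le_rfl)
    (coeFn_theta k t f), ae_restrict_mem measurableSet_Ico,
    Lp.coeFn_zero k 2 ((volume : Measure ℝ).restrict (Set.Ico 0 (t : ℝ)))] with r h1 h2 hr h0
  have hr' : r ∉ Set.Ici (t : ℝ) := fun h' => absurd hr.2 (not_lt.2 h')
  rw [h1, h2, h0, Set.indicator_of_notMem hr']
  rfl

theorem after_theta (t : ℝ≥0) (f : L2 k (Set.Ici 0)) :
    after t (theta k t f) = shiftInto k t f := by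
  refine Lp.ext ?_
  filter_upwards [coeFn_after t (theta k t f), ae_mono (Measure.restrict_mono
    (μ := (volume : Measure ℝ)) (Set.Ici_subset_Ici.2 t.coe_nonneg) le_rfl)
    (coeFn_theta k t f), ae_restrict_mem measurableSet_Ici,
    Lp.coeFn_compMeasurePreserving f (measurePreserving_sub t)] with r h1 h2 hr h3
  rw [h1, h2, Set.indicator_of_mem hr]
  exact h3.symm

theorem shiftInto_leftShift (t : ℝ≥0) (f : L2 k (Set.Ici 0)) :
    shiftInto k t (leftShift t f) = after t f := by
  refine Lp.ext ?_
  filter_upwards [Lp.coeFn_compMeasurePreserving (leftShift t f) (measurePreserving_sub t),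
    (measurePreserving_sub t).quasiMeasurePreserving.ae_eq_comp (coeFn_leftShift t f),
    coeFn_after t f] with r h1 h2 h3
  refine h1.trans (h2.trans ?_)
  rw [h3, Function.comp_apply, sub_add_cancel]

theorem continuous_theta (f : L2 k (Set.Ici 0)) : Continuous fun t : ℝ≥0 => theta k t f := by
  have h : (fun t : ℝ≥0 => theta k t f) = fun t : ℝ≥0 =>
      LpToLpRestrictCLM ℝ k ℂ volume 2 (Set.Ici 0) (translate f t) := by
    ext1 t
    refine Lp.ext ?_
    filter_upwards [coeFn_theta k t f, LpToLpRestrictCLM_coeFn ℂ (Set.Ici 0) (translate f t),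
      ae_restrict_of_ae (coeFn_translate f t)] with r h1 h2 h3
    rw [h1, h2, h3]
    simp only [Set.indicator_apply, Set.mem_Ici, sub_nonneg]
  rw [h]
  exact (LpToLpRestrictCLM ℝ k ℂ volume 2 (Set.Ici 0)).continuous.comp
    ((continuous_translate f).comp NNReal.continuous_coe)

theorem continuous_leftShift (f : L2 k (Set.Ici 0)) :
    Continuous fun t : ℝ≥0 => leftShift t f := by
  have h : (fun t : ℝ≥0 => leftShift t f) = fun t : ℝ≥0 =>
      LpToLpRestrictCLM ℝ k ℂ volume 2 (Set.Ici 0) (translate f (-t)) := by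
    ext1 t
    refine Lp.ext ?_
    filter_upwards [coeFn_leftShift t f, LpToLpRestrictCLM_coeFn ℂ (Set.Ici 0) (translate f (-t)),
      ae_restrict_of_ae (coeFn_translate f (-t)), ae_restrict_mem measurableSet_Ici]
      with r h1 h2 h3 hr
    rw [h1, h2, h3, sub_neg_eq_add, Set.indicator_of_mem]
    exact add_nonneg hr t.coe_nonneg
  rw [h]
  exact (LpToLpRestrictCLM ℝ k ℂ volume 2 (Set.Ici 0)).continuous.comp
    ((continuous_translate f).comp NNReal.continuous_coe.neg)

/-- Strong continuity upgrades to a moving argument because every θ_t is isometric: split u(t) as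
(u(t) − u(t₀)) + u(t₀). -/
theorem continuous_theta_comp {u : ℝ≥0 → L2 k (Set.Ici 0)} (hu : Continuous u) :
    Continuous fun t : ℝ≥0 => theta k t (u t) := by
  rw [continuous_iff_continuousAt]
  intro t₀
  have h1 : Tendsto (fun t : ℝ≥0 => theta k t (u t - u t₀)) (𝓝 t₀) (𝓝 0) := by
    rw [tendsto_zero_iff_norm_tendsto_zero]
    simp_rw [LinearIsometry.norm_map]
    exact tendsto_iff_norm_sub_tendsto_zero.1 (hu.tendsto t₀)
  have h2 := h1.add ((continuous_theta (u t₀)).tendsto t₀)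
  simp_rw [← map_add, sub_add_cancel, zero_add] at h2
  exact h2

/-- The concatenation of `f|_[0, t)` and the right shift of `h` by `t`. -/
noncomputable def glue (t : ℝ≥0) (f h : L2 k (Set.Ici 0)) : L2 k (Set.Ici 0) :=
  f + theta k t (h - leftShift t f)

theorem before_glue (t : ℝ≥0) (f h : L2 k (Set.Ici 0)) : before t (glue t f h) = before t f := by
  rw [glue, before_add, before_theta, add_zero]

theorem after_glue (t : ℝ≥0) (f h : L2 k (Set.Ici 0)) :
    after t (glue t f h) = shiftInto k t h := by
  rw [glue, after_add, after_theta, map_sub, shiftInto_leftShift, add_sub_cancel]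

theorem glue_leftShift {t : ℝ≥0} {f g : L2 k (Set.Ici 0)} (h : before t g = before t f) :
    glue t f (leftShift t g) = g :=
  L2.ext_before_after ((before_glue _ _ _).trans h.symm)
    ((after_glue _ _ _).trans (shiftInto_leftShift _ _))

/-- Continuity is visible from the definition of `glue` by a correction term: `f` is kept, and only
the shifted difference depends on t. -/
theorem continuous_glue (f h : L2 k (Set.Ici 0)) : Continuous fun t : ℝ≥0 => glue t f h :=
  continuous_const.add (continuous_theta_comp (continuous_const.sub (continuous_leftShift f)))

theorem inner_glue (t : ℝ≥0) (f g h h' : L2 k (Set.Ici 0)) :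
    inner ℂ (glue t f h) (glue t g h') = inner ℂ (before t f) (before t g) + inner ℂ h h' := by
  rw [← inner_before_add_inner_after t, before_glue, before_glue, after_glue, after_glue,
    LinearIsometry.inner_map_map]

theorem glue_zero (t : ℝ≥0) : glue t (0 : L2 k (Set.Ici 0)) 0 = 0 := by
  have h := inner_glue t (0 : L2 k (Set.Ici 0)) 0 0 0
  rw [before_zero, inner_zero_left, inner_zero_left, add_zero] at h
  exact inner_self_eq_zero.1 h

end Shift

/-! ### Exponential vectors and the operators x ↦ ε(f|_[0,t)) ⊗ Γ_t x. -/

section Mixed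

universe u

theorem continuous_expVec {H : Type u} [NormedAddCommGroup H] [InnerProductSpace ℂ H] :
    Continuous (expVec : H → Fock H) := by
  rw [continuous_iff_continuousAt]
  intro f
  rw [ContinuousAt, tendsto_iff_norm_sub_tendsto_zero]
  have h : ∀ g : H, ‖expVec g - expVec f‖ ^ 2 = (Complex.exp (inner ℂ g g)
      - Complex.exp (inner ℂ g f) - Complex.exp (inner ℂ f g) + Complex.exp (inner ℂ f f)).re := by
    intro g
    rw [@norm_sq_eq_re_inner ℂ, inner_sub_left, inner_sub_right, inner_sub_right]
    simp only [inner_expVec, RCLike.re_to_complex]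
    congr 1
    ring
  have h1 : Tendsto (fun g : H => ‖expVec g - expVec f‖ ^ 2) (𝓝 f) (𝓝 0) := by
    simp_rw [h]
    have hc : Continuous fun g : H => (Complex.exp (inner ℂ g g)
      - Complex.exp (inner ℂ g f) - Complex.exp (inner ℂ f g)
        + Complex.exp (inner ℂ f f) : ℂ).re := by fun_prop
    simpa using hc.tendsto f
  simpa [Real.sqrt_sq] using h1.sqrt

theorem one_le_norm_expVec {H : Type u} [NormedAddCommGroup H] [InnerProductSpace ℂ H] (f : H) :
    1 ≤ ‖expVec f‖ := by
  have h := inner_expVec f f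
  rw [inner_self_eq_norm_sq_to_K, inner_self_eq_norm_sq_to_K] at h
  have h2 : ‖expVec f‖ ^ 2 = Real.exp (‖f‖ ^ 2) := by
    apply Complex.ofReal_injective
    push_cast
    exact h
  rw [← one_le_sq_iff₀ (norm_nonneg _), h2]
  exact Real.one_le_exp (sq_nonneg _)

theorem inner_expVec_zero {H : Type u} [NormedAddCommGroup H] [InnerProductSpace ℂ H] (f : H) :
    inner ℂ (expVec f) (expVec (0 : H)) = 1 := by
  rw [inner_expVec, inner_zero_right, Complex.exp_zero]

variable {k : Type u} [NormedAddCommGroup k] [InnerProductSpace ℂ k]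

theorem inner_combine (t : ℝ≥0) (u u' : FockBefore k t) (v v' : FockAfter k t) :
    inner ℂ (combine t u v) (combine t u' v') = inner ℂ u u' * inner ℂ v v' := by
  rw [combine, combine, LinearIsometryEquiv.inner_map_map, inner_htmul]

theorem combine_expVec (t : ℝ≥0) (f : L2 k (Set.Ici 0)) :
    combine t (expVec (before t f)) (expVec (after t f)) = expVec f := by
  rw [combine, LinearIsometryEquiv.symm_apply_eq, split_expVec]

/-- The operator `x ↦ ε(f|_[0, t)) ⊗ Γ_t x`. -/
noncomputable def mixedShift (f : L2 k (Set.Ici 0)) (t : ℝ≥0) : FockSpace k →L[ℂ] FockSpace k :=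
  (split k t).symm.toLinearIsometry.toContinuousLinearMap ∘L
    UniformSpace.Completion.toComplL ∘L
      ((TensorProduct.mkL ℂ (FockBefore k t) (FockAfter k t)) (expVec (before t f))) ∘L
        (shiftAfter k t).toContinuousLinearMap

theorem mixedShift_apply (f : L2 k (Set.Ici 0)) (t : ℝ≥0) (x : FockSpace k) :
    mixedShift f t x = combine t (expVec (before t f)) (shiftAfter k t x) := rfl

theorem mixedShift_expVec (f : L2 k (Set.Ici 0)) (t : ℝ≥0) (h : L2 k (Set.Ici 0)) :
    mixedShift f t (expVec h) = expVec (glue t f h) := by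
  rw [mixedShift_apply, shiftAfter, secondQuant_expVec, ← after_glue t f h, ← before_glue t f h,
    combine_expVec]

/-- Displays ε(f) as a mixed vector at every time t. This permits comparison of mixed vectors with
the fixed vector ε(f). -/
theorem mixedShift_expVec_leftShift (f : L2 k (Set.Ici 0)) (t : ℝ≥0) :
    mixedShift f t (expVec (leftShift t f)) = expVec f := by
  rw [mixedShift_expVec, glue_leftShift rfl]

theorem shiftAfter_expVec_zero (t : ℝ≥0) : shiftAfter k t (expVec 0) = expVec 0 := by
  rw [shiftAfter, secondQuant_expVec, map_zero]

theorem inner_mixedShift (f g : L2 k (Set.Ici 0)) (t : ℝ≥0) (x y : FockSpace k) :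
    inner ℂ (mixedShift f t x) (mixedShift g t y)
      = Complex.exp (inner ℂ (before t f) (before t g)) * inner ℂ x y := by
  rw [mixedShift_apply, mixedShift_apply, inner_combine, inner_expVec,
    LinearIsometry.inner_map_map]

theorem norm_mixedShift (f : L2 k (Set.Ici 0)) (t : ℝ≥0) (x : FockSpace k) :
    ‖mixedShift f t x‖ = ‖expVec (before t f)‖ * ‖x‖ := by
  have h := inner_mixedShift f f t x x
  rw [← inner_expVec, inner_self_eq_norm_sq_to_K, inner_self_eq_norm_sq_to_K,
    inner_self_eq_norm_sq_to_K, ← mul_pow] at h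
  have h2 : ‖mixedShift f t x‖ ^ 2 = (‖expVec (before t f)‖ * ‖x‖) ^ 2 := by exact_mod_cast h
  exact (sq_eq_sq₀ (norm_nonneg _) (by positivity)).1 h2

theorem norm_le_norm_mixedShift (f : L2 k (Set.Ici 0)) (t : ℝ≥0) (x : FockSpace k) :
    ‖x‖ ≤ ‖mixedShift f t x‖ := by
  rw [norm_mixedShift]
  exact le_mul_of_one_le_left (norm_nonneg _) (one_le_norm_expVec _)

/-- The point is uniformity in t: ‖ε(f|_[0,t))‖ ≤ ‖ε(f)‖, since ε(f) is the mixed vector of an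
exponential of norm at least 1. -/
theorem norm_mixedShift_le (f : L2 k (Set.Ici 0)) (t : ℝ≥0) (x : FockSpace k) :
    ‖mixedShift f t x‖ ≤ ‖expVec f‖ * ‖x‖ := by
  rw [norm_mixedShift]
  refine mul_le_mul_of_nonneg_right ?_ (norm_nonneg _)
  have h := norm_mixedShift f t (expVec (leftShift t f))
  rw [mixedShift_expVec_leftShift] at h
  rw [h]
  exact le_mul_of_one_le_right (norm_nonneg _) (one_le_norm_expVec _)

/-- A closed linear condition holds everywhere once it holds for exponential vectors. -/
theorem forall_of_expVec {H : Type u} [NormedAddCommGroup H] [InnerProductSpace ℂ H]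
    (W : Submodule ℂ (Fock H)) (hW : IsClosed (W : Set (Fock H))) (h : ∀ f, expVec f ∈ W)
    (x : Fock H) : x ∈ W := by
  have hle : (⊤ : Submodule ℂ (Fock H)) ≤ W := by
    rw [← span_expVec H]
    exact Submodule.topologicalClosure_minimal _ (Submodule.span_le.2 (Set.range_subset_iff.2 h)) hW
  exact hle Submodule.mem_top

theorem clm_ext_expVec {H : Type u} [NormedAddCommGroup H] [InnerProductSpace ℂ H] {E : Type*}
    [NormedAddCommGroup E] [InnerProductSpace ℂ E] {T T' : Fock H →L[ℂ] E}
    (h : ∀ f, T (expVec f) = T' (expVec f)) : T = T' :=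
  ContinuousLinearMap.ext_on (Submodule.dense_iff_topologicalClosure_eq_top.2 (span_expVec H))
    (Set.forall_mem_range.2 h)

/-- On exponential vectors this is continuity of `glue`. The vectors with the property form a
subspace, closed because the operators are bounded uniformly in t. -/
theorem continuous_mixedShift (f : L2 k (Set.Ici 0)) (x : FockSpace k) :
    Continuous fun t => mixedShift f t x := by
  let W : Submodule ℂ (FockSpace k) :=
    { carrier := {x | Continuous fun t => mixedShift f t x}
      add_mem' := fun hx hy => by
        simp only [Set.mem_ofPred_eq, map_add] at hx hy ⊢
        exact hx.add hy
      zero_mem' := by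
        simp only [Set.mem_ofPred_eq, map_zero]
        exact continuous_const
      smul_mem' := fun c x hx => by
        simp only [Set.mem_ofPred_eq, map_smul] at hx ⊢
        exact hx.const_smul c }
  refine forall_of_expVec W ?_ (fun h => ?_) x
  · refine isClosed_of_closure_subset fun y hy => ?_
    refine continuous_of_uniform_approx_of_continuous fun U hU => ?_
    obtain ⟨η, hη, hU⟩ := Metric.mem_uniformity_dist.1 hU
    have hpos : 0 < ‖expVec f‖ := one_pos.trans_le (one_le_norm_expVec f)
    obtain ⟨z, hz, hyz⟩ := Metric.mem_closure_iff.1 hy (η / ‖expVec f‖) (by positivity)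
    refine ⟨_, hz, fun t => hU ?_⟩
    rw [dist_eq_norm, ← map_sub]
    refine (norm_mixedShift_le f t _).trans_lt ?_
    rwa [← dist_eq_norm, mul_comm, ← lt_div_iff₀ hpos]
  · change Continuous fun t => mixedShift f t (expVec h)
    simp_rw [mixedShift_expVec]
    exact continuous_expVec.comp (continuous_glue f h)

/-- An exponential vector is carried to one whose function agrees with f before t, hence before s,
so it lies in the range at time s; that range is closed since `mixedShift f s` is bounded below.
This lets integrands at two times be compared through adaptedness at the earlier one. -/
theorem mixedShift_mem_range {s t : ℝ≥0} (hst : s ≤ t) (f : L2 k (Set.Ici 0)) (x : FockSpace k) :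
    ∃ z, mixedShift f s z = mixedShift f t x := by
  have hanti : AntilipschitzWith 1 (mixedShift f s) :=
    AddMonoidHomClass.antilipschitz_of_bound _ fun x => by
      simpa using norm_le_norm_mixedShift f s x
  have hcl : IsClosed ((mixedShift f s).range : Set (FockSpace k)) := by
    rw [LinearMap.coe_range]
    exact hanti.isClosed_range (mixedShift f s).uniformContinuous
  refine forall_of_expVec ((mixedShift f s).range.comap (mixedShift f t).toLinearMap)
    (hcl.preimage (mixedShift f t).continuous) (fun h => ?_) x
  refine ⟨expVec (leftShift s (glue t f h)), ?_⟩
  change mixedShift f s _ = mixedShift f t (expVec h)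
  rw [mixedShift_expVec, mixedShift_expVec,
    glue_leftShift (before_eq_of_le hst (before_glue t f h))]

/-- The residual is orthogonal to every u ⊗ ε(0) because ⟨ε(h), ε(0)⟩ = 1 for every h. -/
theorem timeProj_expVec (f : L2 k (Set.Ici 0)) (s : ℝ≥0∞) :
    timeProj k s (expVec f) = mixed f (fun _ => expVec 0) s := by
  rw [timeProj, mixed]
  split_ifs with h
  · rfl
  · refine Submodule.eq_starProjection_of_mem_of_inner_eq_zero ?_ fun w hw => ?_
    · exact Submodule.le_topologicalClosure _ (Submodule.subset_span ⟨_, rfl⟩)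
    · set y := expVec f - combine s.toNNReal (expVec (before s.toNNReal f)) (expVec 0) with hy
      have hle : (Submodule.span ℂ (Set.range fun u : FockBefore k s.toNNReal =>
          combine s.toNNReal u (expVec 0))).topologicalClosure
            ≤ LinearMap.ker (innerSL ℂ y).toLinearMap := by
        refine Submodule.topologicalClosure_minimal _ (Submodule.span_le.2 ?_)
          (innerSL ℂ y).isClosed_ker
        rintro _ ⟨u, rfl⟩
        change inner ℂ y _ = 0
        rw [hy, inner_sub_left, ← combine_expVec s.toNNReal f, inner_combine, inner_combine,
          inner_expVec_zero, inner_expVec_zero, sub_self]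
      exact hle hw

end Mixed

/-! ### Adaptedness and existence of the stop-time integrals. -/

section Integral

universe u

variable {k : Type u} [NormedAddCommGroup k] [InnerProductSpace ℂ k]

theorem QuantumStopTime.exists_inner_upTo_expVec (S : QuantumStopTime k) {c : ℝ≥0} (hc : 0 < c) :
    ∃ T : FockBefore k c →L[ℂ] FockBefore k c, ∀ f g : L2 k (Set.Ici 0),
      inner ℂ (S.upTo c (expVec f)) (expVec g)
        = inner ℂ (T (expVec (before c f))) (expVec (before c g))
          * Complex.exp (inner ℂ (after c f) (after c g)) := by
  obtain ⟨T, hT⟩ := S.adapted c hc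
  refine ⟨T, fun f g => ?_⟩
  rw [← combine_expVec c f, ← combine_expVec c g, upTo, hT, inner_combine, inner_expVec (after c f)]

/-- Adaptedness, expressed by matrix elements between the vectors `ε(f|_[0, s)) ⊗ Γ_s x`. -/
theorem QuantumStopTime.IsFinite.inner_upTo_mixedShift_expVec {S : QuantumStopTime k}
    (hS : S.IsFinite) (f g : L2 k (Set.Ici 0)) {s : ℝ≥0} {c : ℝ≥0∞} (hc : c ≤ s)
    (h h' : L2 k (Set.Ici 0)) :
    inner ℂ (S.upTo c (mixedShift f s (expVec h))) (mixedShift g s (expVec h'))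
      = inner ℂ (S.upTo c (mixedShift f s (expVec 0))) (mixedShift g s (expVec 0))
        * inner ℂ (expVec h) (expVec h') := by
  lift c to ℝ≥0 using ne_top_of_le_ne_top ENNReal.coe_ne_top hc
  rcases eq_or_ne c 0 with rfl | hc0
  -- Adaptedness is only assumed at positive times; at c = 0 both sides vanish because S({0}) = 0.
  · rw [ENNReal.coe_zero, hS.upTo_zero, hS.upTo_zero, inner_zero_left, inner_zero_left, zero_mul]
  · have hcs : c ≤ s := ENNReal.coe_le_coe.1 hc
    obtain ⟨T, hT⟩ := S.exists_inner_upTo_expVec (pos_iff_ne_zero.2 hc0)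
    have hb : ∀ f h : L2 k (Set.Ici 0), before c (glue s f h) = before c f := fun f h =>
      before_eq_of_le hcs (before_glue s f h)
    -- After time c the inner product depends on h and h' only through the summand ⟨h, h'⟩, which
    -- the exponential turns into the factor ⟨ε(h), ε(h')⟩.
    have ha : ∀ h h' : L2 k (Set.Ici 0), (inner ℂ (after c (glue s f h)) (after c (glue s g h')) : ℂ)
        = inner ℂ (before s f) (before s g) - inner ℂ (before c f) (before c g)
          + inner ℂ h h' := by
      intro h h'
      have h1 := inner_before_add_inner_after c (glue s f h) (glue s g h')
      rw [hb, hb, inner_glue] at h1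
      linear_combination h1
    simp only [mixedShift_expVec, hT, hb, ha, inner_zero_left, add_zero, Complex.exp_add]
    rw [inner_expVec, mul_assoc]

theorem QuantumStopTime.IsFinite.inner_upTo_mixedShift {S : QuantumStopTime k}
    (hS : S.IsFinite) (f g : L2 k (Set.Ici 0)) {s : ℝ≥0} {c : ℝ≥0∞} (hc : c ≤ s)
    (x y : FockSpace k) :
    inner ℂ (S.upTo c (mixedShift f s x)) (mixedShift g s y)
      = inner ℂ (S.upTo c (mixedShift f s (expVec 0))) (mixedShift g s (expVec 0))
        * inner ℂ x y := by
  have extend : ∀ (f g : L2 k (Set.Ici 0)) (x : FockSpace k) (κ : ℂ),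
      (∀ h, inner ℂ (S.upTo c (mixedShift f s x)) (mixedShift g s (expVec h))
        = κ * inner ℂ x (expVec h)) →
      ∀ y, inner ℂ (S.upTo c (mixedShift f s x)) (mixedShift g s y) = κ * inner ℂ x y := by
    intro f g x κ hx y
    exact congrArg (fun T => T y) (clm_ext_expVec
      (T := innerSL ℂ (S.upTo c (mixedShift f s x)) ∘L mixedShift g s)
      (T' := κ • innerSL ℂ x) hx)
  -- Self-adjointness exchanges the two arguments, so extension by linearity and density in the
  -- second slot also handles the first.
  have flip : ∀ x y : FockSpace k, (inner ℂ (S.upTo c (mixedShift g s y)) (mixedShift f s x) : ℂ)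
      = starRingEnd ℂ (inner ℂ (S.upTo c (mixedShift f s x)) (mixedShift g s y)) := by
    intro x y
    rw [inner_conj_symm, ← S.inner_upTo]
  have h1 : ∀ h y, inner ℂ (S.upTo c (mixedShift f s (expVec h))) (mixedShift g s y)
      = inner ℂ (S.upTo c (mixedShift f s (expVec 0))) (mixedShift g s (expVec 0))
        * inner ℂ (expVec h) y := fun h => extend f g _ _ fun h' =>
    hS.inner_upTo_mixedShift_expVec f g hc h h'
  have h2 := extend g f y (starRingEnd ℂ
    (inner ℂ (S.upTo c (mixedShift f s (expVec 0))) (mixedShift g s (expVec 0)))) (fun h => by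
      rw [flip, h1, map_mul, inner_conj_symm y (expVec h)]) x
  rw [flip, ← inner_conj_symm y x, ← map_mul] at h2
  exact (starRingEnd ℂ).injective h2

/-- Both endpoints of the block ending at s are at most s, so the factorisation applies to each of
the two terms of the increment. -/
theorem QuantumStopTime.IsFinite.norm_incr_mixedShift {S : QuantumStopTime k}
    (hS : S.IsFinite) (π : TimePartition ⊤) (f : L2 k (Set.Ici 0)) (s : ℝ≥0) (x : FockSpace k) :
    ‖S.incr π s (mixedShift f s x)‖ = ‖S.incr π s (mixedShift f s (expVec 0))‖ * ‖x‖ := by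
  have h : ∀ x, ((‖S.incr π s (mixedShift f s x)‖ ^ 2 : ℝ) : ℂ)
      = (inner ℂ (S.upTo s (mixedShift f s (expVec 0))) (mixedShift f s (expVec 0))
        - inner ℂ (S.upTo (π.pred s) (mixedShift f s (expVec 0))) (mixedShift f s (expVec 0)))
        * ((‖x‖ ^ 2 : ℝ) : ℂ) := by
    intro x
    rw [norm_sq_eq_inner_of_isStarProjection (S.isStarProjection_incr π s), ← S.inner_incr,
      S.incr_apply, inner_sub_left, hS.inner_upTo_mixedShift f f le_rfl x x,
      hS.inner_upTo_mixedShift f f (π.pred_le _) x x, ← sub_mul, inner_self_eq_norm_sq_to_K]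
    push_cast
    rfl
  have h0 : ‖(expVec 0 : FockSpace k)‖ ^ 2 = 1 := by
    apply Complex.ofReal_injective
    have := inner_expVec_zero (0 : L2 k (Set.Ici 0))
    rw [inner_self_eq_norm_sq_to_K] at this
    push_cast
    exact this
  have h1 := h x
  have h2 := h (expVec 0)
  rw [h0, Complex.ofReal_one, mul_one] at h2
  rw [← h2, ← Complex.ofReal_mul, ← mul_pow] at h1
  exact (sq_eq_sq₀ (norm_nonneg _) (by positivity)).1 (Complex.ofReal_injective h1)

/-- Replaces a vector that varies with the block by the fixed vector ε(f), so that the block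
estimates can be summed by Pythagoras. -/
theorem QuantumStopTime.IsFinite.norm_incr_mixedShift_le {S : QuantumStopTime k}
    (hS : S.IsFinite) (π : TimePartition ⊤) (f : L2 k (Set.Ici 0)) (s : ℝ≥0) (x : FockSpace k) :
    ‖S.incr π s (mixedShift f s x)‖ ≤ ‖S.incr π s (expVec f)‖ * ‖x‖ := by
  rw [hS.norm_incr_mixedShift, ← mixedShift_expVec_leftShift f s,
    hS.norm_incr_mixedShift π f s (expVec (leftShift s f))]
  exact mul_le_mul_of_nonneg_right
    (le_mul_of_one_le_right (norm_nonneg _) (one_le_norm_expVec _)) (norm_nonneg _)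

theorem exists_finset_sample {X : Type*} [PseudoMetricSpace X] {u : ℝ≥0 → X} (hu : Continuous u)
    (b : ℝ≥0) {η : ℝ} (hη : 0 < η) :
    ∃ A : Finset ℝ≥0, b ∈ A ∧ (∀ a ∈ A, a ≤ b) ∧
      ∀ s ≤ b, ∃ r ∈ A, s ≤ r ∧ ∀ r', s ≤ r' → r' ≤ r → dist (u s) (u r') < η := by
  have huc := (isCompact_Icc (a := (0 : ℝ≥0)) (b := b)).uniformContinuousOn_of_continuous
    hu.continuousOn
  obtain ⟨δ, hδ, h⟩ := Metric.uniformContinuousOn_iff.1 huc η hη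
  obtain ⟨d, hd0, hd⟩ : ∃ d : ℝ≥0, 0 < d ∧ (d : ℝ) < δ :=
    ⟨⟨δ / 2, by positivity⟩, half_pos hδ, half_lt_self hδ⟩
  -- The grid of mesh d capped at b; the index ⌈b/d⌉ yields b itself, and s is rounded up to the
  -- grid point of index ⌈s/d⌉.
  refine ⟨(Finset.range (⌈b / d⌉₊ + 1)).image fun i : ℕ => min b ((i : ℝ≥0) * d), ?_, ?_, ?_⟩
  · refine Finset.mem_image.2 ⟨⌈b / d⌉₊, by simp, min_eq_left ?_⟩
    exact (div_le_iff₀ hd0).1 (Nat.le_ceil _)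
  · intro a ha
    obtain ⟨i, -, rfl⟩ := Finset.mem_image.1 ha
    exact min_le_left _ _
  · intro s hs
    have hlt : (⌈s / d⌉₊ : ℝ≥0) * d < s + d := by
      have h1 := Nat.ceil_lt_add_one (zero_le : 0 ≤ s / d)
      have h2 := mul_lt_mul_of_pos_right h1 hd0
      rwa [add_mul, div_mul_cancel₀ _ hd0.ne', one_mul] at h2
    refine ⟨_, Finset.mem_image.2 ⟨⌈s / d⌉₊, ?_, rfl⟩, le_min hs ?_, fun r' h1 h2 => ?_⟩
    · rw [Finset.mem_range, Nat.lt_succ_iff]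
      exact Nat.ceil_le_ceil (div_le_div_of_nonneg_right hs zero_le)
    · exact (div_le_iff₀ hd0).1 (Nat.le_ceil _)
    · refine h s ⟨zero_le, hs⟩ r' ⟨zero_le, h2.trans (min_le_left _ _)⟩ ?_
      have h3 : (r' : ℝ) < s + d := by
        exact_mod_cast (h2.trans (min_le_right _ _)).trans_lt hlt
      have h4 : (s : ℝ) ≤ r' := NNReal.coe_le_coe.2 h1
      rw [NNReal.dist_eq, abs_sub_comm, abs_of_nonneg (by linarith)]
      linarith

/-- A partition which is so fine on `[0, b]` that `u` is almost constant between successive points,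
and which has no finite point after `b`. -/
theorem exists_timePartition_sample {X : Type*} [PseudoMetricSpace X] {u : ℝ≥0 → X}
    (hu : Continuous u) (b : ℝ≥0) {η : ℝ} (hη : 0 < η) :
    ∃ π₀ : TimePartition ⊤, (b : ℝ≥0∞) ∈ π₀.1 ∧ ∀ s r, r ∈ π₀.1 → s ≤ r →
      (∀ r' ∈ π₀.1, s ≤ r' → r ≤ r') →
      (s ≤ b ∧ ∃ s' r' : ℝ≥0, s = s' ∧ r = r' ∧ s' ≤ r' ∧ dist (u s') (u r') < η) ∨
        (¬ s ≤ b ∧ r = ⊤) := by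
  obtain ⟨A, hbA, hA, h⟩ := exists_finset_sample hu b hη
  obtain ⟨π₀, hπ₀⟩ := exists_timePartition_top A
  have hmem : ∀ r, r ∈ π₀.1 ↔ r = 0 ∨ r = ⊤ ∨ ∃ a ∈ A, (a : ℝ≥0∞) = r := fun r => by
    rw [hπ₀]; simp
  refine ⟨π₀, (hmem _).2 (Or.inr (Or.inr ⟨b, hbA, rfl⟩)), fun s r hr hsr hmin => ?_⟩
  by_cases hsb : s ≤ b
  · lift s to ℝ≥0 using ne_top_of_le_ne_top ENNReal.coe_ne_top hsb
    obtain ⟨r₀, hr₀, h1, h2⟩ := h s (ENNReal.coe_le_coe.1 hsb)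
    have hle := hmin r₀ ((hmem _).2 (Or.inr (Or.inr ⟨r₀, hr₀, rfl⟩))) (ENNReal.coe_le_coe.2 h1)
    lift r to ℝ≥0 using ne_top_of_le_ne_top ENNReal.coe_ne_top hle
    have hsr' := ENNReal.coe_le_coe.1 hsr
    exact Or.inl ⟨hsb, s, r, rfl, rfl, hsr', h2 r hsr' (ENNReal.coe_le_coe.1 hle)⟩
  · refine Or.inr ⟨hsb, ?_⟩
    rcases (hmem r).1 hr with rfl | rfl | ⟨a, ha, rfl⟩
    · exact absurd (hsr.trans zero_le) hsb
    · rfl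
    · exact absurd (hsr.trans (ENNReal.coe_le_coe.2 (hA a ha))) hsb

/-- The integrand `s ↦ ε(f|_[0, s)) ⊗ Γ_s x`, with value zero at `s = ∞`. -/
noncomputable def mixedIntegrand (f : L2 k (Set.Ici 0)) (x : FockSpace k) (s : ℝ≥0∞) :
    FockSpace k :=
  if s = ⊤ then 0 else mixedShift f s.toNNReal x

theorem mixedIntegrand_top (f : L2 k (Set.Ici 0)) (x : FockSpace k) :
    mixedIntegrand f x ⊤ = 0 := if_pos rfl

theorem mixedIntegrand_coe (f : L2 k (Set.Ici 0)) (x : FockSpace k) (s : ℝ≥0) :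
    mixedIntegrand f x s = mixedShift f s x := if_neg ENNReal.coe_ne_top

/-- The Cauchy estimate. Blocks up to b contribute the first term, by near-constancy of the
integrand between points of π₀; blocks beyond b contribute the second, by smallness of the tail of
ε(f). -/
theorem QuantumStopTime.IsFinite.exists_stopSum_near {S : QuantumStopTime k} (hS : S.IsFinite)
    (f : L2 k (Set.Ici 0)) (x : FockSpace k) {η : ℝ} (hη : 0 < η) :
    ∃ π₀ : TimePartition ⊤, ∀ π ≥ π₀,
      ‖stopSum S (mixedIntegrand f x) π - stopSum S (mixedIntegrand f x) π₀‖ ^ 2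
        ≤ η ^ 2 * ‖expVec f‖ ^ 2 + ‖x‖ ^ 2 * η ^ 2 := by
  obtain ⟨b, hb⟩ := hS.exists_upTo_near (expVec f) hη
  obtain ⟨π₀, hbπ₀, hπ₀⟩ := exists_timePartition_sample (continuous_mixedShift f x) b hη
  refine ⟨π₀, fun π hπ => ?_⟩
  refine (hS.norm_sq_le_of_incr π _ (expVec f) (expVec f - S.upTo b (expVec f)) (η ^ 2)
    (‖x‖ ^ 2) fun s hs hs0 => ?_).trans
      (by gcongr)
  obtain ⟨r, hr, hsr, hmin⟩ := π₀.exists_next (le_top : s ≤ ⊤)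
  rw [map_sub, incr_stopSum_self S π _ hs hs0, incr_stopSum S hπ _ hs0 hr hsr hmin]
  rcases hπ₀ s r hr hsr hmin with ⟨-, s, r, rfl, rfl, hsr', hd⟩ | ⟨hsb, rfl⟩
  · rw [mixedIntegrand_coe, mixedIntegrand_coe, ← map_sub]
    -- Both samples are now values of `mixedShift f s`, which is bounded below, so their closeness
    -- forces ‖x − z‖ ≤ η.
    obtain ⟨z, hz⟩ := mixedShift_mem_range hsr' f x
    rw [dist_eq_norm] at hd
    rw [← hz, ← map_sub] at hd ⊢
    have hzη := (norm_le_norm_mixedShift f s (x - z)).trans hd.le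
    have h1 := (hS.norm_incr_mixedShift_le π f s (x - z)).trans
      (mul_le_mul_of_nonneg_left hzη (norm_nonneg _))
    have h2 := pow_le_pow_left₀ (norm_nonneg _) h1 2
    rw [mul_pow, mul_comm] at h2
    exact h2.trans (le_add_of_nonneg_right (by positivity))
  -- Beyond b the next point of π₀ is ∞, where the integrand is 0, so only the sum over π
  -- contributes. On such blocks ε(f) and its tail have the same increment.
  · rw [mixedIntegrand_top, map_zero, sub_zero, map_sub, S.incr_upTo π (hπ hbπ₀), if_neg hsb,
      sub_zero]
    rcases eq_or_ne s ⊤ with rfl | hs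
    · rw [mixedIntegrand_top, map_zero, norm_zero, zero_pow two_ne_zero]
      positivity
    · lift s to ℝ≥0 using hs
      rw [mixedIntegrand_coe]
      have h2 := pow_le_pow_left₀ (norm_nonneg _) (hS.norm_incr_mixedShift_le π f s x) 2
      rw [mul_pow, mul_comm] at h2
      exact h2.trans (le_add_of_nonneg_left (by positivity))

theorem QuantumStopTime.IsFinite.exists_hasStopIntegral {S : QuantumStopTime k} (hS : S.IsFinite)
    (f : L2 k (Set.Ici 0)) (x : FockSpace k) :
    ∃ y, HasStopIntegral S ⊤ (mixedIntegrand f x) y := by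
  refine CompleteSpace.complete (Metric.cauchy_iff.2 ⟨inferInstance, fun ε hε => ?_⟩)
  -- The extra 1 makes C positive and ‖ε(f)‖² + ‖x‖² < C² strict.
  set C := ‖expVec f‖ + ‖x‖ + 1 with hC
  have hC0 : 0 < C := by positivity
  obtain ⟨π₀, hπ₀⟩ := hS.exists_stopSum_near f x (η := ε / 2 / C) (by positivity)
  have hle : ∀ π ≥ π₀,
      ‖stopSum S (mixedIntegrand f x) π - stopSum S (mixedIntegrand f x) π₀‖ < ε / 2 := by
    intro π hπ
    refine lt_of_pow_lt_pow_left₀ 2 (by positivity) ((hπ₀ π hπ).trans_lt ?_)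
    have h1 : (ε / 2) ^ 2 = (ε / 2 / C) ^ 2 * C ^ 2 := by
      rw [← mul_pow, div_mul_cancel₀ _ hC0.ne']
    have h2 : ‖expVec f‖ ^ 2 + ‖x‖ ^ 2 < C ^ 2 := by
      rw [hC]
      nlinarith [norm_nonneg (expVec f), norm_nonneg x,
        mul_nonneg (norm_nonneg (expVec f)) (norm_nonneg x)]
    calc _ = (ε / 2 / C) ^ 2 * (‖expVec f‖ ^ 2 + ‖x‖ ^ 2) := by ring
      _ < _ := by rw [h1]; exact mul_lt_mul_of_pos_left h2 (by positivity)
  refine ⟨_, image_mem_map (Ici_mem_atTop π₀), ?_⟩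
  rintro _ ⟨π, hπ, rfl⟩ _ ⟨π', hπ', rfl⟩
  have h1 := hle π hπ
  have h2 := hle π' hπ'
  rw [← dist_eq_norm] at h1 h2
  calc _ ≤ _ := dist_triangle_right _ _ (stopSum S (mixedIntegrand f x) π₀)
    _ < ε / 2 + ε / 2 := add_lt_add h1 h2
    _ = ε := add_halves ε

/-- The integral `∫ S(ds) ε(f|_[0, s)) ⊗ Γ_s x` over `[0, ∞]`. -/
noncomputable def QuantumStopTime.IsFinite.mixedIntegral {S : QuantumStopTime k} (hS : S.IsFinite)
    (f : L2 k (Set.Ici 0)) (x : FockSpace k) : FockSpace k :=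
  (hS.exists_hasStopIntegral f x).choose

theorem QuantumStopTime.IsFinite.hasStopIntegral_mixedIntegral {S : QuantumStopTime k}
    (hS : S.IsFinite) (f : L2 k (Set.Ici 0)) (x : FockSpace k) :
    HasStopIntegral S ⊤ (mixedIntegrand f x) (hS.mixedIntegral f x) :=
  (hS.exists_hasStopIntegral f x).choose_spec

theorem QuantumStopTime.IsFinite.hasStopIntegral_of_eq {S : QuantumStopTime k}
    (hS : S.IsFinite) {f : L2 k (Set.Ici 0)} {x : FockSpace k} {v : ℝ≥0∞ → FockSpace k}
    (h : ∀ s : ℝ≥0, v s = mixedShift f s x) (t : ℝ≥0∞) :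
    HasStopIntegral S t v (S.upTo t (hS.mixedIntegral f x)) := by
  refine (hS.hasStopIntegral_congr (fun s hs => ?_) (hS.hasStopIntegral_mixedIntegral f x)).upTo t
  lift s to ℝ≥0 using hs
  rw [h, mixedIntegrand_coe]

theorem QuantumStopTime.IsFinite.inner_mixedIntegral {S : QuantumStopTime k} (hS : S.IsFinite)
    (f g : L2 k (Set.Ici 0)) (x y : FockSpace k) (c : ℝ≥0∞) :
    inner ℂ (S.upTo c (hS.mixedIntegral f x)) (hS.mixedIntegral g y)
      = inner ℂ (S.upTo c (hS.mixedIntegral f (expVec 0))) (hS.mixedIntegral g (expVec 0))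
        * inner ℂ x y := by
  refine inner_upTo_stopIntegral _ (hS.hasStopIntegral_mixedIntegral f x)
    (hS.hasStopIntegral_mixedIntegral g y) (hS.hasStopIntegral_mixedIntegral f _)
    (hS.hasStopIntegral_mixedIntegral g _) (fun s c hc => ?_) c
  rcases eq_or_ne s ⊤ with rfl | hs
  · simp only [mixedIntegrand_top, map_zero, inner_zero_left, zero_mul]
  · lift s to ℝ≥0 using hs
    simp only [mixedIntegrand_coe]
    exact hS.inner_upTo_mixedShift f g hc x y

/-- View ε(g) as the integral of a constant. At time s the constant is the mixed vector of ε(h),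
with h the left shift of g, and ⟨ε(0), ε(h)⟩ = 1 means that matrix elements cannot tell ε(h) from
ε(0). -/
theorem QuantumStopTime.IsFinite.inner_mixedIntegral_expVec {S : QuantumStopTime k}
    (hS : S.IsFinite) (f g : L2 k (Set.Ici 0)) (c : ℝ≥0∞) :
    inner ℂ (S.upTo c (hS.mixedIntegral f (expVec 0))) (expVec g)
      = inner ℂ (S.upTo c (hS.mixedIntegral f (expVec 0))) (hS.mixedIntegral g (expVec 0)) := by
  have hf := hS.hasStopIntegral_mixedIntegral f (expVec 0)
  have hg := hS.hasStopIntegral_mixedIntegral g (expVec 0)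
  refine (inner_upTo_stopIntegral 1 hf (hS.hasStopIntegral_const (expVec g)) hf hg
    (fun s c hc => ?_) c).trans (mul_one _)
  rcases eq_or_ne s ⊤ with rfl | hs
  · simp only [mixedIntegrand_top, map_zero, inner_zero_left, zero_mul]
  · lift s to ℝ≥0 using hs
    simp only [mixedIntegrand_coe]
    have h := hS.inner_upTo_mixedShift f g hc (expVec 0) (expVec (leftShift s g))
    rwa [mixedShift_expVec_leftShift, ← inner_conj_symm (expVec 0), inner_expVec_zero, map_one] at h

/-! ### The stopped shift, the stopped projections, and totality of the integrals. -/

theorem shift_coe (t : ℝ≥0) (x : FockSpace k) : shift k t x = mixedShift 0 t x := by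
  rw [← combine_shiftAfter, mixedShift_apply, before_zero]

theorem QuantumStopTime.IsFinite.mixedIntegral_zero {S : QuantumStopTime k} (hS : S.IsFinite) :
    hS.mixedIntegral 0 (expVec 0) = expVec 0 := by
  refine tendsto_nhds_unique (hS.hasStopIntegral_mixedIntegral 0 (expVec 0))
    (hS.hasStopIntegral_congr (fun s hs => ?_) (hS.hasStopIntegral_const (expVec 0)))
  lift s to ℝ≥0 using hs
  rw [mixedIntegrand_coe, mixedShift_expVec, glue_zero]

/-- The total family consists of all vectors, so linearity of the integral in x also comes out of
the Gram identity. -/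
theorem QuantumStopTime.IsFinite.exists_stoppedShift {S : QuantumStopTime k} (hS : S.IsFinite) :
    ∃ Γ : FockSpace k →ₗᵢ[ℂ] FockSpace k, ∀ x, Γ x = hS.mixedIntegral 0 x := by
  refine exists_isometry_of_gram (fun x : FockSpace k => x) _ ?_ fun x y => ?_
  · rw [Set.range_id', Submodule.span_univ]
    exact Submodule.dense_iff_topologicalClosure_eq_top.1 dense_univ
  · have h := hS.inner_mixedIntegral 0 0 x y ⊤
    rwa [hS.mixedIntegral_zero, S.upTo_top, S.upTo_top, inner_expVec_zero, one_mul] at h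

/-- The stopped shift `Γ_S`. -/
noncomputable def QuantumStopTime.IsFinite.stoppedShift {S : QuantumStopTime k} (hS : S.IsFinite) :
    FockSpace k →ₗᵢ[ℂ] FockSpace k :=
  hS.exists_stoppedShift.choose

theorem QuantumStopTime.IsFinite.stoppedShift_apply {S : QuantumStopTime k} (hS : S.IsFinite)
    (x : FockSpace k) : hS.stoppedShift x = hS.mixedIntegral 0 x :=
  hS.exists_stoppedShift.choose_spec x

/-- The stopped time projection `E_S`, as the projection onto the closed span of the integrals
`∫ S(ds) E_s ε(f)`. -/
noncomputable def QuantumStopTime.IsFinite.stoppedProj {S : QuantumStopTime k} (hS : S.IsFinite) :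
    FockSpace k →L[ℂ] FockSpace k :=
  (Submodule.span ℂ (Set.range fun f : L2 k (Set.Ici 0) =>
    hS.mixedIntegral f (expVec 0))).topologicalClosure.starProjection

theorem QuantumStopTime.IsFinite.isStarProjection_stoppedProj {S : QuantumStopTime k}
    (hS : S.IsFinite) : IsStarProjection hS.stoppedProj :=
  isStarProjection_starProjection

theorem QuantumStopTime.IsFinite.stoppedProj_expVec {S : QuantumStopTime k} (hS : S.IsFinite)
    (f : L2 k (Set.Ici 0)) : hS.stoppedProj (expVec f) = hS.mixedIntegral f (expVec 0) := by
  refine Submodule.eq_starProjection_of_mem_of_inner_eq_zero ?_ fun w hw => ?_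
  · exact Submodule.le_topologicalClosure _ (Submodule.subset_span ⟨f, rfl⟩)
  · set y := expVec f - hS.mixedIntegral f (expVec 0) with hy
    have hle : (Submodule.span ℂ (Set.range fun f : L2 k (Set.Ici 0) =>
        hS.mixedIntegral f (expVec 0))).topologicalClosure
          ≤ LinearMap.ker (innerSL ℂ y).toLinearMap := by
      refine Submodule.topologicalClosure_minimal _ (Submodule.span_le.2 ?_)
        (innerSL ℂ y).isClosed_ker
      rintro _ ⟨g, rfl⟩
      change inner ℂ y _ = 0
      have h := hS.inner_mixedIntegral_expVec g f ⊤
      rw [S.upTo_top] at h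
      rw [hy, ← inner_conj_symm, inner_sub_right, h, sub_self, map_zero]
    exact hle hw

/-- The range of E_S is invariant under S([0, t]): for y = S([0, t]) E_S ε(f), pairing y with E_S
ε(g) or with ε(g) gives the same number, by `inner_mixedIntegral_expVec` at cut-off t. -/
theorem QuantumStopTime.IsFinite.stoppedProj_upTo_stoppedProj {S : QuantumStopTime k}
    (hS : S.IsFinite) (t : ℝ≥0∞) :
    hS.stoppedProj * (S.upTo t * hS.stoppedProj) = S.upTo t * hS.stoppedProj := by
  refine clm_ext_expVec fun f => ?_
  change hS.stoppedProj (S.upTo t (hS.stoppedProj (expVec f)))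
    = S.upTo t (hS.stoppedProj (expVec f))
  rw [hS.stoppedProj_expVec]
  set y := S.upTo t (hS.mixedIntegral f (expVec 0)) with hy
  have h : innerSL ℂ (hS.stoppedProj y) = innerSL ℂ y := by
    refine clm_ext_expVec fun g => ?_
    change inner ℂ (hS.stoppedProj y) (expVec g) = inner ℂ y (expVec g)
    rw [← ContinuousLinearMap.adjoint_inner_right,
      ContinuousLinearMap.isSelfAdjoint_iff'.1 hS.isStarProjection_stoppedProj.isSelfAdjoint,
      hS.stoppedProj_expVec, hy, hS.inner_mixedIntegral_expVec]
  exact ext_inner_right ℂ fun z => congrArg (fun T => T z) h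

theorem commute_of_mul_mul_eq {R : Type*} [Semigroup R] [StarMul R] {p e : R}
    (hp : IsSelfAdjoint p) (he : IsSelfAdjoint e) (h : e * (p * e) = p * e) : Commute p e := by
  have h' := congrArg star h
  rw [star_mul, star_mul, he.star_eq, hp.star_eq, mul_assoc, h] at h'
  exact h'

/-- The stopped time projection `E_{S,t}`. -/
noncomputable def QuantumStopTime.IsFinite.stoppedProjUpTo {S : QuantumStopTime k}
    (hS : S.IsFinite) (t : ℝ≥0∞) : FockSpace k →L[ℂ] FockSpace k :=
  S.upTo t * hS.stoppedProj

theorem QuantumStopTime.IsFinite.stoppedProjUpTo_apply {S : QuantumStopTime k}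
    (hS : S.IsFinite) (t : ℝ≥0∞) (x : FockSpace k) :
    hS.stoppedProjUpTo t x = S.upTo t (hS.stoppedProj x) := rfl

theorem QuantumStopTime.IsFinite.isStarProjection_stoppedProjUpTo {S : QuantumStopTime k}
    (hS : S.IsFinite) (t : ℝ≥0∞) : IsStarProjection (hS.stoppedProjUpTo t) :=
  (S.isStarProjection_upTo t).mul hS.isStarProjection_stoppedProj
    (commute_of_mul_mul_eq (S.isStarProjection_upTo t).isSelfAdjoint
      hS.isStarProjection_stoppedProj.isSelfAdjoint (hS.stoppedProj_upTo_stoppedProj t))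

theorem QuantumStopTime.IsFinite.stoppedProjUpTo_expVec {S : QuantumStopTime k}
    (hS : S.IsFinite) (t : ℝ≥0∞) (f : L2 k (Set.Ici 0)) :
    hS.stoppedProjUpTo t (expVec f) = S.upTo t (hS.mixedIntegral f (expVec 0)) := by
  rw [stoppedProjUpTo_apply, stoppedProj_expVec]

theorem QuantumStopTime.IsFinite.stoppedProjUpTo_stoppedProjUpTo {S : QuantumStopTime k}
    (hS : S.IsFinite) (s t : ℝ≥0∞) (x : FockSpace k) :
    hS.stoppedProjUpTo s (hS.stoppedProjUpTo t x) = hS.stoppedProjUpTo (min s t) x := by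
  have h : hS.stoppedProj (S.upTo t (hS.stoppedProj x)) = S.upTo t (hS.stoppedProj x) :=
    congrArg (fun T => T x) (hS.stoppedProj_upTo_stoppedProj t)
  simp only [stoppedProjUpTo_apply]
  rw [h, S.upTo_upTo]

theorem QuantumStopTime.IsFinite.stoppedProjUpTo_mem_range {S : QuantumStopTime k}
    (hS : S.IsFinite) (t : ℝ≥0∞) (x : FockSpace k) :
    hS.stoppedProjUpTo t x ∈ LinearMap.range (hS.stoppedProjUpTo ⊤).toLinearMap := by
  refine ⟨hS.stoppedProjUpTo t x, ?_⟩
  have h := hS.stoppedProjUpTo_stoppedProjUpTo ⊤ t x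
  rwa [min_eq_right le_top] at h

/-- The exponential vectors are approximated by the integrals `∫ S(ds) ε(f|_[0, s)) ⊗ Γ_s x` over
subintervals. -/
theorem QuantumStopTime.IsFinite.expVec_mem {S : QuantumStopTime k} (hS : S.IsFinite)
    (R : Submodule ℂ (FockSpace k)) (hR : IsClosed (R : Set (FockSpace k)))
    (h : ∀ t f x, S.upTo t (hS.mixedIntegral f x) ∈ R) (g : L2 k (Set.Ici 0)) : expVec g ∈ R := by
  have happrox : ∀ η : ℝ, 0 < η → ∃ y ∈ R, ‖expVec g - y‖ ^ 2 ≤ η ^ 2 * ‖expVec g‖ ^ 2 + η ^ 2 := by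
    intro η hη
    obtain ⟨b, hb⟩ := hS.exists_upTo_near (expVec g) hη
    set u : ℝ≥0 → FockSpace k := fun s => expVec (leftShift s g)
    have hu : Continuous u := continuous_expVec.comp (continuous_leftShift g)
    obtain ⟨π₀, hbπ₀, hπ₀⟩ := exists_timePartition_sample hu b hη
    -- On each block of π₀ the argument u(s) is frozen at the right endpoint r. The resulting blocks
    -- of mixed integrals are differences of vectors in R.
    set w : ℝ≥0∞ → FockSpace k := fun r =>
      if r = ⊤ then 0 else hS.mixedIntegral g (u r.toNNReal) with hw
    -- Here the integrals are replaced by Riemann sums over a finer π, for which blockwise estimates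
    -- are available; π₀ stays fixed while π is refined.
    set wπ : TimePartition ⊤ → ℝ≥0∞ → FockSpace k := fun π r =>
      if r = ⊤ then 0 else stopSum S (mixedIntegrand g (u r.toNNReal)) π with hwπ
    have hlim : Tendsto (fun π => stopSum S (wπ π) π₀) atTop (𝓝 (stopSum S w π₀)) := by
      simp_rw [stopSum_eq]
      refine tendsto_finsetSum _ fun r _ => ((S.incr π₀ r).continuous.tendsto _).comp ?_
      simp only [hw, hwπ]
      split_ifs with hr
      · exact tendsto_const_nhds
      · exact hS.hasStopIntegral_mixedIntegral g _
    refine ⟨stopSum S w π₀, ?_, ?_⟩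
    · rw [stopSum_eq]
      refine R.sum_mem fun r _ => ?_
      simp only [hw]
      split_ifs
      · rw [map_zero]
        exact R.zero_mem
      · rw [S.incr_apply]
        exact R.sub_mem (h _ _ _) (h _ _ _)
    · refine le_of_tendsto ((tendsto_const_nhds.sub hlim).norm.pow 2)
        ((eventually_ge_atTop π₀).mono fun π hπ => ?_)
      refine (hS.norm_sq_le_of_incr π _ (expVec g) (expVec g - S.upTo b (expVec g)) (η ^ 2)
        1 fun s hs hs0 => ?_).trans (by rw [one_mul]; gcongr)
      obtain ⟨r, hr, hsr, hmin⟩ := π₀.exists_next (le_top : s ≤ ⊤)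
      rw [map_sub, incr_stopSum S hπ _ hs0 hr hsr hmin]
      rcases hπ₀ s r hr hsr hmin with ⟨-, s, r, rfl, rfl, hsr', hd⟩ | ⟨hsb, rfl⟩
      -- On the block ending at s the approximant is the mixed vector of u(r) and ε(g) is the mixed
      -- vector of u(s), so u(s) − u(r) governs the error.
      · have h1 : S.incr π s (wπ π r) = S.incr π s (mixedShift g s (u r)) := by
          simp only [hwπ, if_neg ENNReal.coe_ne_top, ENNReal.toNNReal_coe]
          rw [incr_stopSum_self S π _ hs hs0, mixedIntegrand_coe]
        have h2 : S.incr π s (expVec g) = S.incr π s (mixedShift g s (u s)) := by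
          rw [mixedShift_expVec_leftShift]
        rw [dist_eq_norm] at hd
        have h3 := (hS.norm_incr_mixedShift_le π g s (u s - u r)).trans
          (mul_le_mul_of_nonneg_left hd.le (norm_nonneg _))
        rw [map_sub, map_sub, ← h1, ← h2] at h3
        have h4 := pow_le_pow_left₀ (norm_nonneg _) h3 2
        rw [mul_pow, mul_comm] at h4
        exact h4.trans (le_add_of_nonneg_right (by positivity))
      · have h1 : wπ π ⊤ = 0 := if_pos rfl
        rw [h1, map_zero, sub_zero, map_sub, S.incr_upTo π (hπ hbπ₀), if_neg hsb, sub_zero, one_mul]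
        exact le_add_of_nonneg_left (by positivity)
  rw [← SetLike.mem_coe, ← hR.closure_eq, Metric.mem_closure_iff]
  intro ε hε
  set C := ‖expVec g‖ + 1 with hC
  have hC0 : 0 < C := by positivity
  obtain ⟨y, hy, hle⟩ := happrox (ε / 2 / C) (by positivity)
  refine ⟨y, hy, ?_⟩
  rw [dist_eq_norm]
  refine lt_of_pow_lt_pow_left₀ 2 hε.le (hle.trans_lt ?_)
  have h1 : (ε / 2) ^ 2 = (ε / 2 / C) ^ 2 * C ^ 2 := by
    rw [← mul_pow, div_mul_cancel₀ _ hC0.ne']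
  have h2 : ‖expVec g‖ ^ 2 + 1 ≤ C ^ 2 := by
    rw [hC]
    nlinarith [norm_nonneg (expVec g)]
  calc _ = (ε / 2 / C) ^ 2 * (‖expVec g‖ ^ 2 + 1) := by ring
    _ ≤ (ε / 2 / C) ^ 2 * C ^ 2 := mul_le_mul_of_nonneg_left h2 (by positivity)
    _ = (ε / 2) ^ 2 := h1.symm
    _ < ε ^ 2 := by nlinarith

end Integral

/-! ### The tensor-product isomorphism. -/

section Isomorphism

universe u

variable {k : Type u} [NormedAddCommGroup k] [InnerProductSpace ℂ k]

/-- A continuous map onto its range sends a dense subspace to a dense one. -/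
theorem span_range_codRestrict {ι E F : Type*} [NormedAddCommGroup E] [InnerProductSpace ℂ E]
    [NormedAddCommGroup F] [InnerProductSpace ℂ F] (T : E →L[ℂ] F) (e : ι → E)
    (he : (Submodule.span ℂ (Set.range e)).topologicalClosure = ⊤)
    (e' : ι → LinearMap.range T.toLinearMap) (h : ∀ i, (e' i : F) = T (e i)) :
    (Submodule.span ℂ (Set.range e')).topologicalClosure = ⊤ := by
  have h1 : DenseRange T.rangeRestrict :=
    (LinearMap.surjective_rangeRestrict T.toLinearMap).denseRange
  have h2 := h1.dense_image T.rangeRestrict.continuous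
    (Submodule.dense_iff_topologicalClosure_eq_top.2 he)
  refine Submodule.dense_iff_topologicalClosure_eq_top.1 (h2.mono ?_)
  rintro _ ⟨x, hx, rfl⟩
  have hle : Submodule.span ℂ (Set.range e)
      ≤ (Submodule.span ℂ (Set.range e')).comap T.rangeRestrict.toLinearMap := by
    refine Submodule.span_le.2 ?_
    rintro _ ⟨i, rfl⟩
    refine Submodule.subset_span ⟨i, Subtype.ext (h i)⟩
  exact hle hx

theorem span_range_rangeRestrict {E F : Type*} [NormedAddCommGroup E] [InnerProductSpace ℂ E]
    [NormedAddCommGroup F] [InnerProductSpace ℂ F] (V : E →ₗᵢ[ℂ] F) :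
    (Submodule.span ℂ (Set.range fun x => (⟨V x, LinearMap.mem_range_self _ x⟩ :
      LinearMap.range V.toLinearMap))).topologicalClosure = ⊤ := by
  rw [Submodule.eq_top_iff']
  rintro ⟨_, x, rfl⟩
  exact Submodule.le_topologicalClosure _ (Submodule.subset_span ⟨x, rfl⟩)

/-- An isomorphism onto `H` from the tensor product of two subspaces, determined by its values on a
total family of elementary tensors. -/
theorem exists_tensorEquiv_of_gram {ι κ H : Type*} [NormedAddCommGroup H] [InnerProductSpace ℂ H]
    [CompleteSpace H] (K L : Submodule ℂ H) (e : ι → K) (e' : κ → L)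
    (he : (Submodule.span ℂ (Set.range e)).topologicalClosure = ⊤)
    (he' : (Submodule.span ℂ (Set.range e')).topologicalClosure = ⊤) (w : ι → κ → H)
    (hw : ∀ i x j y, inner ℂ (w i x) (w j y)
      = inner ℂ (e i : H) (e j) * inner ℂ (e' x : H) (e' y))
    (htot : ∀ R : Submodule ℂ H, IsClosed (R : Set H) → (∀ i x, w i x ∈ R) → ∀ x, x ∈ R) :
    ∃ j : HTensor K L ≃ₗᵢ[ℂ] H, ∀ i x, j (htmul (e i) (e' x)) = w i x := by
  obtain ⟨U, hU⟩ := exists_isometry_of_gram (fun p : ι × κ => htmul (e p.1) (e' p.2))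
    (fun p => w p.1 p.2) (span_htmul _ _ he he') (fun p q => by
      rw [inner_htmul, Submodule.coe_inner, Submodule.coe_inner, hw])
  have hcl : IsClosed (SetLike.coe (LinearMap.range U.toLinearMap)) := by
    rw [LinearMap.coe_range]
    exact U.isometry.isClosedEmbedding.isClosed_range
  have hsurj : Function.Surjective U := htot _ hcl fun i x => ⟨_, hU (i, x)⟩
  exact ⟨LinearIsometryEquiv.ofSurjective U hsurj, fun i x => hU (i, x)⟩

theorem QuantumStopTime.IsFinite.span_stoppedProjUpTo {S : QuantumStopTime k} (hS : S.IsFinite) :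
    (Submodule.span ℂ (Set.range fun p : ℝ≥0∞ × L2 k (Set.Ici 0) =>
      (⟨hS.stoppedProjUpTo p.1 (expVec p.2), hS.stoppedProjUpTo_mem_range p.1 _⟩ :
        LinearMap.range (hS.stoppedProjUpTo ⊤).toLinearMap))).topologicalClosure = ⊤ := by
  have h := span_range_codRestrict (hS.stoppedProjUpTo ⊤) expVec (span_expVec (L2 k (Set.Ici 0)))
    (fun f => ⟨hS.stoppedProjUpTo ⊤ (expVec f), hS.stoppedProjUpTo_mem_range ⊤ _⟩) fun _ => rfl
  refine top_unique (h.symm.le.trans (Submodule.topologicalClosure_mono (Submodule.span_mono ?_)))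
  rintro _ ⟨f, rfl⟩
  exact ⟨(⊤, f), rfl⟩

/-- The Gram identity behind j_S. Self-adjointness moves one cut-off across, the two merge into
S([0, s ∧ t]), and the factorisation at that cut-off applies. -/
theorem QuantumStopTime.IsFinite.inner_upTo_mixedIntegral {S : QuantumStopTime k}
    (hS : S.IsFinite) (s t : ℝ≥0∞) (f g : L2 k (Set.Ici 0)) (x y : FockSpace k) :
    inner ℂ (S.upTo s (hS.mixedIntegral f x)) (S.upTo t (hS.mixedIntegral g y))
      = inner ℂ (hS.stoppedProjUpTo s (expVec f)) (hS.stoppedProjUpTo t (expVec g))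
        * inner ℂ x y := by
  rw [hS.stoppedProjUpTo_expVec, hS.stoppedProjUpTo_expVec, ← S.inner_upTo, ← S.inner_upTo,
    S.upTo_upTo, S.upTo_upTo, hS.inner_mixedIntegral]

/-- The isomorphism `j_S`. -/
theorem QuantumStopTime.IsFinite.exists_tensorEquiv {S : QuantumStopTime k} (hS : S.IsFinite)
    (Γ : FockSpace k →ₗᵢ[ℂ] FockSpace k) :
    ∃ j : HTensor (LinearMap.range (hS.stoppedProjUpTo ⊤).toLinearMap)
        (LinearMap.range Γ.toLinearMap) ≃ₗᵢ[ℂ] FockSpace k,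
      ∀ t f x, j (htmul ⟨hS.stoppedProjUpTo t (expVec f), hS.stoppedProjUpTo_mem_range t _⟩
          ⟨Γ x, LinearMap.mem_range_self _ x⟩) = S.upTo t (hS.mixedIntegral f x) := by
  have h := exists_tensorEquiv_of_gram _ _ _ _ hS.span_stoppedProjUpTo
    (span_range_rangeRestrict Γ) (fun p x => S.upTo p.1 (hS.mixedIntegral p.2 x))
    (fun p x q y => (hS.inner_upTo_mixedIntegral _ _ _ _ _ _).trans
      (congrArg _ (Γ.inner_map_map _ _).symm))
    (fun R hR h x => forall_of_expVec R hR (hS.expVec_mem R hR fun t f x => h (t, f) x) x)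
  exact h.imp fun j hj t f x => hj (t, f) x

end Isomorphism

end CCR

theorem mainTheorem8 {k : Type*} [NormedAddCommGroup k] [InnerProductSpace ℂ k]
    [CompleteSpace k] (S : CCR.QuantumStopTime k) (hS : S.IsFinite) :
    ∃ (E : ℝ≥0∞ → (CCR.FockSpace k →L[ℂ] CCR.FockSpace k))
      (Γ : CCR.FockSpace k →ₗᵢ[ℂ] CCR.FockSpace k),
      -- the time projections `E_{S,t}`
      (∀ t : ℝ≥0∞, 0 < t →
        IsStarProjection (E t) ∧
        ∀ f : CCR.L2 k (Set.Ici 0),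
          CCR.HasStopIntegral S t (fun s => CCR.timeProj k s (CCR.expVec f))
            (E t (CCR.expVec f)) ∧
          CCR.HasStopIntegral S t (CCR.mixed f (fun _ => CCR.expVec 0))
            (E t (CCR.expVec f))) ∧
      (∀ s t : ℝ≥0∞, 0 < s → 0 < t →
        E s ∘L E t = E (min s t) ∧ E t ∘L E s = E (min s t)) ∧
      (∀ s : ℝ≥0∞, 0 < s → S.proj (Set.Icc 0 s) ∘L E ⊤ = E s) ∧
      -- the stopped shift `Γ_S`
      (∀ x : CCR.FockSpace k,
        CCR.HasStopIntegral S ⊤ (fun s => CCR.shift k s x) (Γ x) ∧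
        CCR.HasStopIntegral S ⊤ (CCR.mixed 0 (fun s => CCR.shiftAfter k s x)) (Γ x)) ∧
      -- the isomorphism `j_S`, with `E_S = E_{S,∞}`
      ∃ j : CCR.HTensor (LinearMap.range (E ⊤).toLinearMap) (LinearMap.range Γ.toLinearMap)
          ≃ₗᵢ[ℂ] CCR.FockSpace k,
        ∀ (t : ℝ≥0∞), 0 < t → ∀ (f : CCR.L2 k (Set.Ici 0)) (x : CCR.FockSpace k),
          ∃ h : E t (CCR.expVec f) ∈ LinearMap.range (E ⊤).toLinearMap,
            CCR.HasStopIntegral S t (CCR.mixed f (fun s => CCR.shiftAfter k s x))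
              (j (CCR.htmul ⟨E t (CCR.expVec f), h⟩ ⟨Γ x, LinearMap.mem_range_self _ x⟩)) := by
  have hmixed : ∀ (f : CCR.L2 k (Set.Ici 0)) (x : CCR.FockSpace k) (s : ℝ≥0),
      CCR.mixed f (fun s => CCR.shiftAfter k s x) s = CCR.mixedShift f s x :=
    fun f x s => if_neg ENNReal.coe_ne_top
  -- The vacuum is fixed by Γ_s, so E_s ε(f) is the mixed integrand with x = ε(0).
  have hmixed0 : ∀ (f : CCR.L2 k (Set.Ici 0)) (s : ℝ≥0),
      CCR.mixed f (fun _ => CCR.expVec 0) s = CCR.mixedShift f s (CCR.expVec 0) := by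
    intro f s
    rw [← hmixed]
    simp only [CCR.shiftAfter_expVec_zero]
  refine ⟨hS.stoppedProjUpTo, hS.stoppedShift, fun t _ => ⟨hS.isStarProjection_stoppedProjUpTo t, fun f => ?_⟩,
    fun s t _ _ => ⟨?_, ?_⟩, fun s _ => ?_, fun x => ?_, ?_⟩
  · have h := hS.hasStopIntegral_of_eq (hmixed0 f) t
    rw [← hS.stoppedProjUpTo_expVec] at h
    refine ⟨?_, h⟩
    simp_rw [CCR.timeProj_expVec]
    exact h
  · exact ContinuousLinearMap.ext (hS.stoppedProjUpTo_stoppedProjUpTo s t)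
  · rw [min_comm]
    exact ContinuousLinearMap.ext (hS.stoppedProjUpTo_stoppedProjUpTo t s)
  · exact ContinuousLinearMap.ext fun x => congrArg (S.upTo s) (S.upTo_top _)
  · have h : ∀ {v : ℝ≥0∞ → CCR.FockSpace k}, (∀ s : ℝ≥0, v s = CCR.mixedShift 0 s x) →
        CCR.HasStopIntegral S ⊤ v (hS.stoppedShift x) := fun hv => by
      rw [hS.stoppedShift_apply, ← S.upTo_top (hS.mixedIntegral 0 x)]
      exact hS.hasStopIntegral_of_eq hv ⊤
    exact ⟨h fun s => CCR.shift_coe s x, h (hmixed 0 x)⟩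
  · refine (hS.exists_tensorEquiv hS.stoppedShift).imp fun j hj t _ f x =>
      ⟨hS.stoppedProjUpTo_mem_range t _, ?_⟩
    rw [hj]
    exact hS.hasStopIntegral_of_eq (hmixed f x) t
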